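/- For a finite graph $G$, the burning number $b(G)$ is the least $b$ such that the vertices of $G$ can be covered by balls (in the graph distance, with arbitrary centres) of radii $0,1,\dots,b-1$. There is a function $e:\mathbb N\to\mathbb R$, $b\mapsto e_b$, with $e_b\to 0$ as $b\to\infty$, such that for every $k\in\mathbb N$ there is a randomized algorithm with the following properties. Given a graph $G$ on the $n$ vertices $0,\dots,n-1$ (by its adjacency matrix), it always halts after a number of steps bounded by a polynomial in $n$ and outputs a natural number $r$ that always satisfies $r\ge b(G)$. Moreover there is a constant $C$ such that for every $n\ge 1$ and every graph $G$ on $n$ vertices, with probability at least $1-C/n^{k}$, $$r\le\left(\frac{2}{1-e^{-2}}+e_{b(G)}\right)b(G).$$ Here $2/(1-e^{-2})=2.313\dots$, that is, $2.313<2/(1-e^{-2})<2.314$. (In $e^{-2}$, $e$ is Euler's number.) The algorithm runs on a random access machine with unit-cost operations (addition, truncated subtraction, direct and indirect memory access, zero tests, fair coin tosses; no multiplication). -/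

import Mathlib

open Filter Topology MeasureTheory

/-- The burning number of `G`: the least `b` such that the vertices can be covered by balls
(with arbitrary centres) of radii `0, 1, …, b - 1`. The distance is the extended graph distance,
which is infinite between different connected components. -/
noncomputable def burningNumber {V : Type*} (G : SimpleGraph V) : ℕ :=
  sInf {b : ℕ | ∃ c : Fin b → V, ∀ v : V, ∃ i : Fin b, G.edist (c i) v ≤ ((i : ℕ) : ℕ∞)}

/-! ### Randomized random access machines

The machine has registers and (finitely many, per program) unbounded arrays of natural numbers.
Programs are built from elementary instructions by sequencing, branching and looping. Every
elementary operation (a constant, a register access, an indirect array access, an addition, a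
truncated subtraction, an assignment, a test, a coin toss) costs one step. There is no
multiplication, so that one step at most doubles the largest number stored
(or brings in a constant of the program), and polynomial time on this machine is the usual
polynomial time. -/

namespace RAM

/-- A configuration: the registers, the arrays, and the number of coins tossed so far. -/
structure State where
  reg : ℕ → ℕ
  arr : ℕ → ℕ → ℕ
  coins : ℕ

/-- Arithmetic expressions. `read a i` is the entry of array `a` at the index given by `i`. -/
inductive Exp where
  | const (c : ℕ)
  | reg (x : ℕ)
  | read (a : ℕ) (i : Exp)
  | add (e f : Exp)
  | sub (e f : Exp)

/-- The value of an expression; subtraction is truncated at `0`. -/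
def Exp.eval (s : State) : Exp → ℕ
  | .const c => c
  | .reg x => s.reg x
  | .read a i => s.arr a (i.eval s)
  | .add e f => e.eval s + f.eval s
  | .sub e f => e.eval s - f.eval s

/-- The number of elementary operations needed to evaluate an expression. -/
def Exp.cost : Exp → ℕ
  | .const _ => 1
  | .reg _ => 1
  | .read _ i => i.cost + 1
  | .add e f => e.cost + f.cost + 1
  | .sub e f => e.cost + f.cost + 1

/-- Programs. `assign x e` puts the value of `e` into register `x`; `write a i e` puts it into
array `a` at index `i`; `toss x` puts a fresh random bit into register `x`; the tests of `cond`
and `loop` are passed if the value of the expression is nonzero. -/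
inductive Prog where
  | skip
  | assign (x : ℕ) (e : Exp)
  | write (a : ℕ) (i e : Exp)
  | toss (x : ℕ)
  | seq (p q : Prog)
  | cond (e : Exp) (p q : Prog)
  | loop (e : Exp) (p : Prog)

/-- `Exec ω p s s' t`: with the outcomes `ω 0, ω 1, …` of the coin tosses, the program `p`,
started in configuration `s`, halts in configuration `s'` after exactly `t` steps. -/
inductive Exec (ω : ℕ → Bool) : Prog → State → State → ℕ → Prop
  | skip (s : State) : Exec ω .skip s s 1
  | assign (x : ℕ) (e : Exp) (s : State) :
      Exec ω (.assign x e) s { s with reg := Function.update s.reg x (e.eval s) } (e.cost + 1)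
  | write (a : ℕ) (i e : Exp) (s : State) :
      Exec ω (.write a i e) s
        { s with
          arr := Function.update s.arr a (Function.update (s.arr a) (i.eval s) (e.eval s)) }
        (i.cost + e.cost + 1)
  | toss (x : ℕ) (s : State) :
      Exec ω (.toss x) s
        { s with reg := Function.update s.reg x (ω s.coins).toNat, coins := s.coins + 1 } 1
  | seq {p q : Prog} {s₁ s₂ s₃ : State} {t u : ℕ} :
      Exec ω p s₁ s₂ t → Exec ω q s₂ s₃ u → Exec ω (.seq p q) s₁ s₃ (t + u)
  | cond_then {e : Exp} {p q : Prog} {s s' : State} {t : ℕ} :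
      e.eval s ≠ 0 → Exec ω p s s' t → Exec ω (.cond e p q) s s' (e.cost + 1 + t)
  | cond_else {e : Exp} {p q : Prog} {s s' : State} {t : ℕ} :
      e.eval s = 0 → Exec ω q s s' t → Exec ω (.cond e p q) s s' (e.cost + 1 + t)
  | loop_stop {e : Exp} {p : Prog} {s : State} :
      e.eval s = 0 → Exec ω (.loop e p) s s (e.cost + 1)
  | loop_step {e : Exp} {p : Prog} {s₁ s₂ s₃ : State} {t u : ℕ} :
      e.eval s₁ ≠ 0 → Exec ω p s₁ s₂ t → Exec ω (.loop e p) s₂ s₃ u →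
        Exec ω (.loop e p) s₁ s₃ (e.cost + 1 + t + u)

/-- For given outcomes of the coin tosses there is at most one halting computation. -/
theorem Exec.deterministic {ω : ℕ → Bool} {p : Prog} {s s₁ s₂ : State} {t₁ t₂ : ℕ}
    (h₁ : Exec ω p s s₁ t₁) (h₂ : Exec ω p s s₂ t₂) : s₁ = s₂ ∧ t₁ = t₂ := by
  induction h₁ generalizing s₂ t₂ with
  | skip s => cases h₂; exact ⟨rfl, rfl⟩
  | assign x e s => cases h₂; exact ⟨rfl, rfl⟩
  | write a i e s => cases h₂; exact ⟨rfl, rfl⟩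
  | toss x s => cases h₂; exact ⟨rfl, rfl⟩
  | seq _ _ ih ih' =>
    cases h₂ with
    | seq a b =>
      obtain ⟨rfl, rfl⟩ := ih a
      obtain ⟨rfl, rfl⟩ := ih' b
      exact ⟨rfl, rfl⟩
  | cond_then h _ ih =>
    cases h₂ with
    | cond_then _ a => obtain ⟨rfl, rfl⟩ := ih a; exact ⟨rfl, rfl⟩
    | cond_else h' _ => exact absurd h' h
  | cond_else h _ ih =>
    cases h₂ with
    | cond_then h' _ => exact absurd h h'
    | cond_else _ a => obtain ⟨rfl, rfl⟩ := ih a; exact ⟨rfl, rfl⟩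
  | loop_stop h =>
    cases h₂ with
    | loop_stop _ => exact ⟨rfl, rfl⟩
    | loop_step h' _ _ => exact absurd h h'
  | loop_step h _ _ ih ih' =>
    cases h₂ with
    | loop_stop h' => exact absurd h' h
    | loop_step _ a b =>
      obtain ⟨rfl, rfl⟩ := ih a
      obtain ⟨rfl, rfl⟩ := ih' b
      exact ⟨rfl, rfl⟩

open Classical in
/-- The initial configuration for the input graph `G` on the vertices `0, …, n - 1`: register `0`
holds `n`, array `0` holds the adjacency matrix row by row, and everything else is `0`. -/
noncomputable def init {n : ℕ} (G : SimpleGraph (Fin n)) : State where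
  reg := fun x => if x = 0 then n else 0
  arr := fun a p =>
    if a = 0 ∧ ∃ i j : Fin n, G.Adj i j ∧ p = (i : ℕ) * n + (j : ℕ) then 1 else 0
  coins := 0

/-- `A` assigns to each graph and each sequence of coin tosses an output. It is a randomized
polynomial-time algorithm if a single program computes it, always halting (whatever the coins
show) within a number of steps bounded by a polynomial in the number of vertices.
The output is read off register `0`. -/
def IsRandomizedPolyTime (A : (n : ℕ) → SimpleGraph (Fin n) → (ℕ → Bool) → ℕ) : Prop :=
  ∃ (P : Prog) (p : Polynomial ℕ), ∀ (n : ℕ) (G : SimpleGraph (Fin n)) (ω : ℕ → Bool),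
    ∃ (s : State) (t : ℕ), Exec ω P (init G) s t ∧ t ≤ p.eval n ∧ s.reg 0 = A n G ω

end RAM

/-- The law of an infinite sequence of independent fair coin tosses. -/
noncomputable def coinMeasure : Measure (ℕ → Bool) :=
  Measure.infinitePi fun _ : ℕ => (PMF.uniformOfFintype Bool).toMeasure

/-! Fix a cover by `b = b(G)` balls of radii `0, …, b - 1`, and split the radii below `R = 2 ^ m *
L` into `2 ^ m` classes of `L` consecutive ones. One pass scans the vertices and puts a ball of
radius `a * L`, with `a` uniform below `2 ^ m`, at each vertex that is still uncovered. If no class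
is used more than `L` times, the balls of class `a` can be given distinct radii from `a * L` to `a *
L + L - 1`, so `b(G) ≤ R` (`burningNumber_le_of_covered`). Failed passes are discarded, hence the
output is always valid.

If an uncovered vertex lies in the optimal ball of radius `i`, a new radius of at least `2 * i`
swallows that whole ball. This has probability about `1 - 2i/R`, so the expected number of balls
placed is at most about `∑ 1 / (1 - 2i/R) ≈ -(R/2) log (1 - 2b/R)`. In the limit this is below the
number `R` of available radii exactly when `R > 2b / (1 - e⁻²)`. Markov's inequality bounds the
chance of placing more than `T` balls, with `T` slightly below `R`. A second moment bound shows that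
the uniform classes rarely exceed `L`. Both estimates are packed into one supermartingale
(`sum_potential_cons_le`, `expect_attempt_le`).

For a fixed excess `η` over the ratio, the bound on the failure probability of a pass tends to a
constant below `1` as `b → ∞`, so it is eventually below `exp (-1/√b)` (`eventually_good`). As `b ≤
n`, all of `n` passes fail with probability at most `exp (-n/√b) ≤ exp (-√n)`, which beats every
power of `n`. Since `b` is unknown, all pairs with `2 ^ m * L ≤ n` are tried; one algorithm serves
every `k`.

`CoinTree` separates the two halves: its `run` is matched with the machine
(`steps_approximateProg`), its `expect` carries the probability estimates, and `coinMeasure_run_le`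
links them. -/

/-! ### Coin-tossing computations: execution and expectation. -/

/-- A finite computation that tosses coins. -/
inductive CoinTree (α : Type*) where
  | ret (a : α)
  | toss (f : Bool → CoinTree α)

namespace CoinTree

variable {α β : Type*}

/-- Sequential composition. -/
def bind : CoinTree α → (α → CoinTree β) → CoinTree β
  | ret a, g => g a
  | toss f, g => toss fun x => (f x).bind g

/-- The result, and the position of the next unused coin, when the coins from position `pos` of
`ω` are used. -/
def run (ω : ℕ → Bool) : CoinTree α → ℕ → α × ℕ
  | ret a, pos => (a, pos)
  | toss f, pos => (f (ω pos)).run ω (pos + 1)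

/-- The expected value of `g` at the result. -/
noncomputable def expect : CoinTree α → (α → ℝ) → ℝ
  | ret a, g => g a
  | toss f, g => ((f false).expect g + (f true).expect g) / 2

/-- All possible results satisfy `Q`. -/
def All (Q : α → Prop) : CoinTree α → Prop
  | ret a => Q a
  | toss f => ∀ x, (f x).All Q

/-- The iteration of `f 0`, `f 1`, …, `f (k - 1)`. -/
def iter (f : ℕ → α → CoinTree α) : ℕ → α → CoinTree α
  | 0, a => ret a
  | k + 1, a => (iter f k a).bind (f k)

theorem run_bind (ω : ℕ → Bool) (t : CoinTree α) (g : α → CoinTree β) (pos : ℕ) :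
    (t.bind g).run ω pos = (g (t.run ω pos).1).run ω (t.run ω pos).2 := by
  induction t generalizing pos with
  | ret a => rfl
  | toss f ih => exact ih _ _

theorem expect_bind (t : CoinTree α) (g : α → CoinTree β) (h : β → ℝ) :
    (t.bind g).expect h = t.expect fun a => (g a).expect h := by
  induction t with
  | ret a => rfl
  | toss f ih => simp only [bind, expect, ih]

theorem expect_mono {t : CoinTree α} {g h : α → ℝ} (hgh : ∀ a, g a ≤ h a) :
    t.expect g ≤ t.expect h := by
  induction t with
  | ret a => exact hgh a
  | toss f ih => simp only [expect]; linarith [ih false, ih true]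

theorem expect_const (t : CoinTree α) (c : ℝ) : t.expect (fun _ => c) = c := by
  induction t with
  | ret a => rfl
  | toss f ih => simp only [expect, ih]; ring

theorem expect_mul_left (t : CoinTree α) (c : ℝ) (g : α → ℝ) :
    t.expect (fun a => c * g a) = c * t.expect g := by
  induction t with
  | ret a => rfl
  | toss f ih => simp only [expect, ih]; ring

theorem All.run {Q : α → Prop} {t : CoinTree α} (ht : t.All Q) (ω : ℕ → Bool) (pos : ℕ) :
    Q (t.run ω pos).1 := by
  induction t generalizing pos with
  | ret a => exact ht
  | toss f ih => exact ih _ (ht _) _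

theorem All.bind {Q : α → Prop} {Q' : β → Prop} {t : CoinTree α} {g : α → CoinTree β}
    (ht : t.All Q) (hg : ∀ a, Q a → (g a).All Q') : (t.bind g).All Q' := by
  induction t with
  | ret a => exact hg a ht
  | toss f ih => exact fun x => ih x (ht x)

theorem all_iter {Q : ℕ → α → Prop} {f : ℕ → α → CoinTree α} {k : ℕ}
    (hf : ∀ i < k, ∀ a, Q i a → (f i a).All (Q (i + 1))) {a : α} (ha : Q 0 a) :
    (iter f k a).All (Q k) := by
  induction k with
  | zero => exact ha
  | succ k ih => exact (ih fun i hi => hf i (by omega)).bind (hf k (by omega))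

theorem expect_iter_le {φ : α → ℝ} {f : ℕ → α → CoinTree α} {k : ℕ}
    (hf : ∀ i < k, ∀ a, (f i a).expect φ ≤ φ a) (a : α) : (iter f k a).expect φ ≤ φ a := by
  induction k with
  | zero => exact le_rfl
  | succ k ih =>
    rw [iter, expect_bind]
    exact (expect_mono (hf k (by omega))).trans (ih fun i hi => hf i (by omega))

/-- A single decisive stage suffices: it brings the expectation below `q` from any state, and later
stages do not raise it. -/
theorem expect_iter_le_of_index {φ : α → ℝ} {f : ℕ → α → CoinTree α} {k j : ℕ} {q : ℝ}
    (hf : ∀ i < k, ∀ a, (f i a).expect φ ≤ φ a) (hj : j < k) (hq : ∀ a, (f j a).expect φ ≤ q)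
    (a : α) : (iter f k a).expect φ ≤ q := by
  induction k with
  | zero => omega
  | succ k ih =>
    rw [iter, expect_bind]
    rcases Nat.lt_succ_iff_lt_or_eq.1 hj with h | rfl
    · exact (expect_mono (hf k (by omega))).trans (ih (fun i hi => hf i (by omega)) h)
    · exact (expect_mono hq).trans (expect_const _ _).le

theorem expect_iter_le_pow {φ : α → ℝ} {f : ℕ → α → CoinTree α} {q : ℝ} (hq : 0 ≤ q)
    (hf : ∀ i a, (f i a).expect φ ≤ q * φ a) (k : ℕ) (a : α) :
    (iter f k a).expect φ ≤ q ^ k * φ a := by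
  induction k with
  | zero => simp [iter, expect]
  | succ k ih =>
    rw [iter, expect_bind]
    refine (expect_mono (hf k)).trans ?_
    rw [expect_mul_left, pow_succ', mul_assoc]
    exact mul_le_mul_of_nonneg_left ih hq

theorem coinMeasure_cylinder (w : ℕ → Bool) (pos : ℕ) :
    coinMeasure {ω | ∀ i < pos, ω i = w i} ≤ ENNReal.ofReal ((1 / 2) ^ pos) := by
  have h : {ω : ℕ → Bool | ∀ i < pos, ω i = w i} =
      Set.pi (Finset.range pos) fun i => {w i} := by
    ext ω; simp [Set.mem_pi]
  have h2 : ∀ x : Bool, (PMF.uniformOfFintype Bool).toMeasure {x} = ENNReal.ofReal (1 / 2) := by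
    intro x
    rw [PMF.toMeasure_apply_singleton _ _ (measurableSet_singleton x)]
    simp [ENNReal.ofReal_inv_of_pos]
  rw [h, coinMeasure, Measure.infinitePi_pi _ (fun i _ => measurableSet_singleton _)]
  simp only [h2, Finset.prod_const, Finset.card_range]
  rw [ENNReal.ofReal_pow (by norm_num)]

theorem expect_indicator_nonneg (t : CoinTree α) (E : Set α) :
    0 ≤ t.expect (E.indicator 1) :=
  (expect_const t 0).symm.le.trans
    (expect_mono fun _ => Set.indicator_nonneg (fun _ _ => zero_le_one) _)

/-- Fixing the coins already used makes the induction work: the next coin splits the cylinder in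
two. Only an upper bound is sought, so subadditivity is enough and no measurability of the event is
needed. -/
theorem coinMeasure_run_cylinder_le (t : CoinTree α) (E : Set α) (w : ℕ → Bool) (pos : ℕ) :
    coinMeasure {ω | (∀ i < pos, ω i = w i) ∧ (t.run ω pos).1 ∈ E} ≤
      ENNReal.ofReal ((1 / 2) ^ pos * t.expect (E.indicator 1)) := by
  induction t generalizing pos w with
  | ret a =>
    by_cases ha : a ∈ E
    · simpa [run, expect, ha] using coinMeasure_cylinder w pos
    · simp [run, expect, ha]
  | toss f ih =>
    have hsub : {ω : ℕ → Bool | (∀ i < pos, ω i = w i) ∧ ((toss f).run ω pos).1 ∈ E} ⊆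
        ⋃ x : Bool, {ω | (∀ i < pos + 1, ω i = Function.update w pos x i) ∧
          ((f x).run ω (pos + 1)).1 ∈ E} := by
      rintro ω ⟨h, h'⟩
      refine Set.mem_iUnion.2 ⟨ω pos, fun i hi => ?_, h'⟩
      rcases Nat.lt_succ_iff_lt_or_eq.1 hi with hi | rfl
      · rw [Function.update_of_ne hi.ne]; exact h i hi
      · simp
    refine (measure_mono hsub).trans ((measure_iUnion_le _).trans ?_)
    rw [tsum_fintype, Fintype.sum_bool]
    refine (add_le_add (ih true _ _) (ih false _ _)).trans ?_
    rw [← ENNReal.ofReal_add (by have := expect_indicator_nonneg (f true) E; positivity)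
      (by have := expect_indicator_nonneg (f false) E; positivity)]
    apply ENNReal.ofReal_le_ofReal
    simp only [expect, pow_succ]
    linarith

theorem coinMeasure_run_le (t : CoinTree α) (E : Set α) :
    coinMeasure.real {ω | (t.run ω 0).1 ∈ E} ≤ t.expect (E.indicator 1) := by
  have h := coinMeasure_run_cylinder_le t E (fun _ => false) 0
  simp only [Nat.not_lt_zero, false_imp_iff, implies_true, true_and, pow_zero, one_mul] at h
  exact ENNReal.toReal_le_of_le_ofReal (expect_indicator_nonneg t E) h

end CoinTree

/-! ### Rules for bounding the running time and describing the result of programs. -/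

namespace RAM

/-- Started in `s`, the program `P` halts within `T` steps, in a configuration satisfying `Q`. -/
def Steps (ω : ℕ → Bool) (P : Prog) (s : State) (T : ℕ) (Q : State → Prop) : Prop :=
  ∃ s' t, Exec ω P s s' t ∧ t ≤ T ∧ Q s'

variable {ω : ℕ → Bool} {s : State} {Q : State → Prop}

theorem Steps.mono {P : Prog} {T T' : ℕ} {Q' : State → Prop} (h : Steps ω P s T Q) (hT : T ≤ T')
    (hQ : ∀ s', Q s' → Q' s') : Steps ω P s T' Q' := by
  obtain ⟨s', t, h1, h2, h3⟩ := h
  exact ⟨s', t, h1, h2.trans hT, hQ _ h3⟩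

theorem Steps.le {P : Prog} {T T' : ℕ} (h : Steps ω P s T Q) (hT : T ≤ T') :
    Steps ω P s T' Q := h.mono hT fun _ => id

theorem Steps.skip (h : Q s) : Steps ω .skip s 1 Q := ⟨_, _, .skip s, le_rfl, h⟩

theorem Steps.assign {x : ℕ} {e : Exp}
    (h : Q { s with reg := Function.update s.reg x (e.eval s) }) :
    Steps ω (.assign x e) s (e.cost + 1) Q := ⟨_, _, .assign x e s, le_rfl, h⟩

theorem Steps.write {a : ℕ} {i e : Exp}
    (h : Q { s with
      arr := Function.update s.arr a (Function.update (s.arr a) (i.eval s) (e.eval s)) }) :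
    Steps ω (.write a i e) s (i.cost + e.cost + 1) Q := ⟨_, _, .write a i e s, le_rfl, h⟩

theorem Steps.toss {x : ℕ}
    (h : Q { s with reg := Function.update s.reg x (ω s.coins).toNat, coins := s.coins + 1 }) :
    Steps ω (.toss x) s 1 Q := ⟨_, _, .toss x s, le_rfl, h⟩

theorem Steps.seq {P P' : Prog} {T T' : ℕ} (h : Steps ω P s T fun s' => Steps ω P' s' T' Q) :
    Steps ω (.seq P P') s (T + T') Q := by
  obtain ⟨s', t, h1, h2, s'', t', h3, h4, h5⟩ := h
  exact ⟨_, _, .seq h1 h3, by omega, h5⟩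

theorem Steps.cond {e : Exp} {P P' : Prog} {T : ℕ} (h : e.eval s ≠ 0 → Steps ω P s T Q)
    (h' : e.eval s = 0 → Steps ω P' s T Q) : Steps ω (.cond e P P') s (e.cost + 1 + T) Q := by
  by_cases he : e.eval s = 0
  · obtain ⟨s', t, h1, h2, h3⟩ := h' he
    exact ⟨_, _, .cond_else he h1, by omega, h3⟩
  · obtain ⟨s', t, h1, h2, h3⟩ := h he
    exact ⟨_, _, .cond_then he h1, by omega, h3⟩

theorem Steps.loop {e : Exp} {P : Prog} {c N : ℕ} {I : ℕ → State → Prop} (h0 : I 0 s)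
    (hI : ∀ i < N, ∀ s, I i s → e.eval s ≠ 0 ∧ Steps ω P s c (I (i + 1)))
    (hN : ∀ s, I N s → e.eval s = 0) :
    Steps ω (.loop e P) s (N * (e.cost + 1 + c) + (e.cost + 1)) (I N) := by
  -- Induction on the number `k` of rounds still to be made.
  have key : ∀ k ≤ N, ∀ s, I (N - k) s →
      Steps ω (.loop e P) s (k * (e.cost + 1 + c) + (e.cost + 1)) (I N) := by
    intro k
    induction k with
    | zero => exact fun _ s hs => ⟨s, _, Exec.loop_stop (hN s hs), by omega, hs⟩
    | succ k ih =>
      intro hk s hs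
      obtain ⟨he, s', t, h1, h2, h3⟩ := hI _ (by omega) s hs
      rw [show N - (k + 1) + 1 = N - k by omega] at h3
      obtain ⟨s'', t', h4, h5, h6⟩ := ih (by omega) s' h3
      exact ⟨s'', _, .loop_step he h1 h4, by rw [add_mul]; omega, h6⟩
  exact key N le_rfl s (by simpa using h0)

/-- The loop in which register `x` runs through the numbers below the value of register `1`. -/
def forLoop (x : ℕ) (P : Prog) : Prog :=
  .seq (.assign x (.const 0)) (.loop (.sub (.reg 1) (.reg x))
    (.seq P (.assign x (.add (.reg x) (.const 1)))))

/-- The configuration `s` with `v` put into register `x`. -/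
def State.set (s : State) (x v : ℕ) : State := { s with reg := Function.update s.reg x v }

@[simp] theorem State.set_coins (x v : ℕ) : (s.set x v).coins = s.coins := rfl
@[simp] theorem State.set_arr (x v : ℕ) : (s.set x v).arr = s.arr := rfl
@[simp] theorem State.set_reg_self (x v : ℕ) : (s.set x v).reg x = v := by simp [State.set]
theorem State.set_reg (x v y : ℕ) : (s.set x v).reg y = if y = x then v else s.reg y := by
  simp [State.set, Function.update_apply]

/-- `I i` describes the head of round `i`, where the counter already holds `i`; hence `set` in the
hypotheses. Each round costs `c`, plus `4` for the test and `4` for the increment. -/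
theorem Steps.forLoop {x n c : ℕ} {P : Prog} {I : ℕ → State → Prop} (hx : x ≠ 1)
    (hn : s.reg 1 = n) (h0 : I 0 (s.set x 0))
    (hI : ∀ i < n, ∀ s, I i s → s.reg 1 = n → s.reg x = i →
      Steps ω P s c fun s' => s'.reg 1 = n ∧ s'.reg x = i ∧ I (i + 1) (s'.set x (i + 1))) :
    Steps ω (forLoop x P) s (n * (c + 8) + 6) fun s' => s'.reg 1 = n ∧ I n s' := by
  refine Steps.le (T := 2 + (n * (4 + (c + 4)) + 4)) ?_ (by ring_nf; omega)
  refine Steps.seq (Steps.assign ?_)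
  refine Steps.mono (Steps.loop (c := c + 4) (N := n)
    (I := fun i s => s.reg 1 = n ∧ s.reg x = i ∧ I i s) ?_ ?_ ?_) le_rfl
    fun s' h => ⟨h.1, h.2.2⟩
  · refine ⟨?_, by simp [Exp.eval], h0⟩
    simpa [Function.update_apply, hx.symm] using hn
  · rintro i hi s ⟨h1, h2, h3⟩
    refine ⟨by simp [Exp.eval, h1, h2]; omega, Steps.seq ?_⟩
    refine (hI i hi s h3 h1 h2).mono le_rfl ?_
    rintro s' ⟨h4, h5, h6⟩
    refine Steps.assign ⟨?_, ?_, ?_⟩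
    · simpa [Function.update_apply, hx.symm] using h4
    · simp [Exp.eval, h5]
    · rw [show (Exp.add (.reg x) (.const 1)).eval s' = i + 1 by simp [Exp.eval, h5]]
      exact h6
  · rintro s ⟨h1, h2, -⟩
    simp [Exp.eval, h1, h2]

/-- The registers below `k` and all arrays but number `1` are the same. -/
def Frame (k : ℕ) (s s' : State) : Prop :=
  (∀ x < k, s'.reg x = s.reg x) ∧ (∀ a ≠ 1, s'.arr a = s.arr a) ∧ s'.coins = s.coins

theorem Frame.refl (k : ℕ) (s : State) : Frame k s s := ⟨fun _ _ => rfl, fun _ _ => rfl, rfl⟩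

theorem Frame.trans {k : ℕ} {s s' s'' : State} (h : Frame k s s') (h' : Frame k s' s'') :
    Frame k s s'' :=
  ⟨fun x hx => (h'.1 x hx).trans (h.1 x hx), fun a ha => (h'.2.1 a ha).trans (h.2.1 a ha),
    h'.2.2.trans h.2.2⟩

theorem Frame.mono {k k' : ℕ} {s s' : State} (h : Frame k s s') (hk : k' ≤ k) : Frame k' s s' :=
  ⟨fun x hx => h.1 x (hx.trans_le hk), h.2⟩

theorem Frame.set {k : ℕ} {s s' : State} (h : Frame k s s') {x : ℕ} (hx : k ≤ x) (v : ℕ) :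
    Frame k s (s'.set x v) :=
  ⟨fun y hy => by rw [State.set_reg, if_neg (by omega), h.1 y hy], h.2⟩

/-! ### The spreading of balls -/

variable {n : ℕ} {G : SimpleGraph (Fin n)}

/-- `v` is at distance at most `r` from `u`. -/
def Near (G : SimpleGraph (Fin n)) (r : ℕ) (u v : Fin n) : Prop :=
  ∃ p : G.Walk v u, p.length ≤ r

/-- `v` is in one of the balls of the list; the entry `(u, a)` is a ball of radius `a * L`. -/
def Covered (G : SimpleGraph (Fin n)) (L : ℕ) (l : List (Fin n × ℕ)) (v : Fin n) : Prop :=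
  ∃ x ∈ l, Near G (x.2 * L) x.1 v

/-- Positive values of `e` are witnessed by the balls of the list. -/
def Sound (G : SimpleGraph (Fin n)) (L : ℕ) (l : List (Fin n × ℕ)) (e : ℕ → ℕ) : Prop :=
  ∀ v : Fin n, e v ≠ 0 → ∃ x ∈ l, ∃ p : G.Walk v x.1, p.length + e v ≤ x.2 * L + 1

/-- The balls of the list are accounted for by `e`. -/
def Complete (G : SimpleGraph (Fin n)) (L : ℕ) (l : List (Fin n × ℕ)) (e : ℕ → ℕ) : Prop :=
  ∀ x ∈ l, ∀ (v : Fin n) (p : G.Walk v x.1), x.2 * L + 1 ≤ p.length + e v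

/-- The shift by one in `Sound` and `Complete` gives vertices on the rim of a ball the value `1`,
leaving `0` for uncovered ones. -/
theorem covered_iff {L : ℕ} {l : List (Fin n × ℕ)} {e : ℕ → ℕ} (hs : Sound G L l e)
    (hc : Complete G L l e) (v : Fin n) : e v ≠ 0 ↔ Covered G L l v := by
  constructor
  · intro h
    obtain ⟨x, hx, p, hp⟩ := hs v h
    exact ⟨x, hx, p, by omega⟩
  · rintro ⟨x, hx, p, hp⟩
    have := hc x hx v p
    omega

/-- Array `0` holds the adjacency matrix. -/
def HasGraph (G : SimpleGraph (Fin n)) (s : State) : Prop :=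
  ∀ i j : Fin n, s.arr 0 (i * n + j) ≠ 0 ↔ G.Adj i j

theorem hasGraph_init (G : SimpleGraph (Fin n)) : HasGraph G (init G) := by
  intro i j
  have : (∃ i' j' : Fin n, G.Adj i' j' ∧ (i : ℕ) * n + j = i' * n + j') ↔ G.Adj i j := by
    refine ⟨?_, fun h => ⟨i, j, h, rfl⟩⟩
    rintro ⟨i', j', h, h'⟩
    have hn : 0 < n := i.pos
    have e1 : ((i : ℕ) * n + j) / n = i := by
      rw [mul_comm, Nat.mul_add_div hn, Nat.div_eq_of_lt j.2, add_zero]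
    have e2 : ((i' : ℕ) * n + j') / n = i' := by
      rw [mul_comm, Nat.mul_add_div hn, Nat.div_eq_of_lt j'.2, add_zero]
    have hi : i = i' := Fin.ext (by rw [← e1, ← e2, h'])
    subst hi
    have hj : j = j' := Fin.ext (by omega)
    subst hj
    exact h
  simp [init, this]

/-- `e j := max (e j) (e i - 1)` if `i` and `j` are adjacent. -/
def relax : Prog :=
  .cond (.read 0 (.reg 14)) (.write 1 (.reg 13) (.add (.read 1 (.reg 13))
    (.sub (.sub (.read 1 (.reg 12)) (.const 1)) (.read 1 (.reg 13))))) .skip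

def relaxRow : Prog := forLoop 13 (.seq relax (.assign 14 (.add (.reg 14) (.const 1))))

def relaxAll : Prog := .seq (.assign 14 (.const 0)) (forLoop 12 relaxRow)

def propagate : Prog := forLoop 11 relaxAll

/-- Crossing an edge lengthens the witnessing walk by one and uses one unit of residual radius. -/
theorem Sound.update {L : ℕ} {l : List (Fin n × ℕ)} {e : ℕ → ℕ} (hs : Sound G L l e)
    {i j : Fin n} (h : G.Adj i j) :
    Sound G L l (Function.update e j (e j + (e i - 1 - e j))) := by
  intro v hv
  by_cases hvj : v = j
  · subst hvj
    rw [Function.update_self] at hv ⊢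
    by_cases hle : e i - 1 ≤ e v
    · rw [Nat.sub_eq_zero_of_le hle, add_zero] at hv ⊢
      exact hs v hv
    · obtain ⟨x, hx, p, hp⟩ := hs i (by omega)
      exact ⟨x, hx, .cons h.symm p, by rw [SimpleGraph.Walk.length_cons]; omega⟩
  · rw [Function.update_of_ne (by simpa [Fin.ext_iff] using hvj)] at hv ⊢
    exact hs v hv

theorem steps_relaxRow {L : ℕ} {l : List (Fin n × ℕ)} (i : Fin n) (hn : s.reg 1 = n)
    (hG : HasGraph G s) (hi : s.reg 12 = i) (hp : s.reg 14 = i * n) (hs : Sound G L l (s.arr 1)) :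
    Steps ω relaxRow s (n * 27 + 6) fun s' => Frame 13 s s' ∧ s'.reg 14 = (i + 1) * n ∧
      Sound G L l (s'.arr 1) ∧ (∀ u, s.arr 1 u ≤ s'.arr 1 u) ∧
      ∀ j : Fin n, G.Adj i j → s.arr 1 i - 1 ≤ s'.arr 1 j := by
  refine Steps.mono (Steps.forLoop (c := 19) (n := n) (I := fun m s' => Frame 13 s s' ∧
      s'.reg 14 = i * n + m ∧ Sound G L l (s'.arr 1) ∧ (∀ u, s.arr 1 u ≤ s'.arr 1 u) ∧
      ∀ j : Fin n, (j : ℕ) < m → G.Adj i j → s.arr 1 i - 1 ≤ s'.arr 1 j)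
    (by norm_num) hn ?_ ?_) le_rfl ?_
  · refine ⟨(Frame.refl _ _).set le_rfl _, by simp [State.set_reg, hp], hs, fun u => le_rfl, ?_⟩
    intro j hj; omega
  · rintro m hm s₁ ⟨hf, h14, hs₁, hle, hadj⟩ h1 h13
    have h12 : s₁.reg 12 = i := (hf.1 12 (by norm_num)).trans hi
    have h0 : s₁.arr 0 = s.arr 0 := hf.2.1 0 (by norm_num)
    refine Steps.seq (T := 15) (T' := 4) (Steps.cond (T := 12) ?_ ?_)
    · intro he
      have ha : G.Adj i ⟨m, hm⟩ := by
        rw [← hG]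
        simpa [Exp.eval, h14, h0] using he
      refine Steps.write (Steps.assign ?_)
      refine ⟨h1, h13, ⟨?_, ?_, ?_⟩, ?_, ?_, ?_, ?_⟩
      · intro x hx
        simp only [State.set, Function.update_apply]
        rw [if_neg (by omega), if_neg (by omega), hf.1 x hx]
      · intro a ha
        simpa [State.set, Function.update_apply, ha] using hf.2.1 a ha
      · exact hf.2.2
      · simp [State.set, Exp.eval, h14]; omega
      · simpa [State.set, Exp.eval, h13, h12] using hs₁.update ha
      · intro u
        have := hle u
        simp only [State.set, Function.update_apply, Exp.eval, if_true]
        split_ifs with h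
        · rw [← h]; omega
        · exact this
      · intro j hj hij
        have := hle i
        simp only [State.set, Function.update_apply, Exp.eval, if_true, h12, h13]
        split_ifs with h
        · omega
        · exact hadj j (by omega) hij
    · intro he
      have ha : ¬ G.Adj i ⟨m, hm⟩ := by
        rw [← hG, not_not]
        simpa [Exp.eval, h14, h0] using he
      refine Steps.le (T := 1) (Steps.skip (Steps.assign ?_)) (by norm_num)
      refine ⟨h1, h13, ⟨?_, hf.2⟩, ?_, hs₁, hle, ?_⟩
      · intro x hx
        simp only [State.set, Function.update_apply]
        rw [if_neg (by omega), if_neg (by omega), hf.1 x hx]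
      · simp [State.set, Exp.eval, h14]; omega
      · intro j hj hij
        refine hadj j (lt_of_le_of_ne (by omega) fun h => ha ?_) hij
        convert hij; exact h.symm
  · rintro s' ⟨-, hf, h14, h, h', h''⟩
    exact ⟨hf, by rw [h14]; ring, h, h', fun j hj => h'' j j.2 hj⟩

theorem HasGraph.of_frame {k : ℕ} {s s' : State} (hG : HasGraph G s) (hf : Frame k s s') :
    HasGraph G s' := by
  intro i j
  rw [hf.2.1 0 (by norm_num)]
  exact hG i j

theorem steps_relaxAll {L : ℕ} {l : List (Fin n × ℕ)} (hn : s.reg 1 = n)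
    (hG : HasGraph G s) (hs : Sound G L l (s.arr 1)) :
    Steps ω relaxAll s (n * (n * 27 + 14) + 8) fun s' => Frame 12 s s' ∧
      Sound G L l (s'.arr 1) ∧ (∀ u, s.arr 1 u ≤ s'.arr 1 u) ∧
      ∀ i j : Fin n, G.Adj i j → s.arr 1 i - 1 ≤ s'.arr 1 j := by
  refine Steps.le (Steps.seq (Steps.assign (Steps.mono (Steps.forLoop (c := n * 27 + 6) (n := n)
    (I := fun m s' => Frame 12 s s' ∧ s'.reg 14 = m * n ∧
      Sound G L l (s'.arr 1) ∧ (∀ u, s.arr 1 u ≤ s'.arr 1 u) ∧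
      ∀ i j : Fin n, (i : ℕ) < m → G.Adj i j → s.arr 1 i - 1 ≤ s'.arr 1 j)
    (by norm_num) hn ?_ ?_) le_rfl ?_))) (le_of_eq (by simp only [Exp.cost]; ring))
  · refine ⟨⟨?_, fun _ _ => rfl, rfl⟩, by simp [State.set, Exp.eval], hs,
      fun u => le_rfl, fun i j hi => by omega⟩
    intro x hx
    simp only [State.set, Function.update_apply]
    rw [if_neg (by omega), if_neg (by omega)]
  · rintro m hm s₁ ⟨hf, h14, hs₁, hle, hadj⟩ h1 h12
    refine (steps_relaxRow (G := G) ⟨m, hm⟩ h1 (hG.of_frame hf) h12 h14 hs₁).mono le_rfl ?_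
    rintro s₂ ⟨hf₂, h14', hs₂, hle₂, hadj₂⟩
    refine ⟨(hf₂.1 1 (by norm_num)).trans h1, (hf₂.1 12 (by norm_num)).trans h12,
      (hf.trans (hf₂.mono (by norm_num))).set le_rfl _, by simpa [State.set_reg] using h14', hs₂,
      fun u => (hle u).trans (hle₂ u), ?_⟩
    intro i j hi hij
    rcases Nat.lt_succ_iff_lt_or_eq.1 hi with h | h
    · exact (hadj i j h hij).trans (hle₂ j)
    · subst h
      have := hadj₂ j hij
      have := hle i
      simp only [State.set_arr] at *
      omega
  · rintro s' ⟨-, hf, -, h, h', h''⟩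
    exact ⟨hf, h, h', fun i j hj => h'' i j i.2 hj⟩

/-- Bellman–Ford: after `m` rounds all walks of length at most `m` to the new centre are accounted
for. The older balls stay accounted for because entries never decrease. -/
theorem steps_propagate {L a : ℕ} {l : List (Fin n × ℕ)} {v : Fin n} (hn : s.reg 1 = n)
    (hG : HasGraph G s) (hs : Sound G L ((v, a) :: l) (s.arr 1)) (hc : Complete G L l (s.arr 1))
    (hv : s.arr 1 v = a * L + 1) (ha : a * L ≤ n) :
    Steps ω propagate s (n * (n * (n * 27 + 14) + 16) + 6) fun s' => Frame 11 s s' ∧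
      Sound G L ((v, a) :: l) (s'.arr 1) ∧ Complete G L ((v, a) :: l) (s'.arr 1) := by
  refine Steps.mono (Steps.forLoop (c := n * (n * 27 + 14) + 8) (n := n)
    (I := fun m s' => Frame 11 s s' ∧
      Sound G L ((v, a) :: l) (s'.arr 1) ∧ (∀ u, s.arr 1 u ≤ s'.arr 1 u) ∧
      ∀ (u : Fin n) (p : G.Walk u v), p.length ≤ m → a * L + 1 ≤ p.length + s'.arr 1 u)
    (by norm_num) hn ?_ ?_) (le_of_eq (by ring)) ?_
  · refine ⟨(Frame.refl _ _).set le_rfl _, hs, fun u => le_rfl, fun u p hp => ?_⟩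
    cases p with
    | nil => simp [hv]
    | cons h p => simp at hp
  · rintro m hm s₁ ⟨hf, hs₁, hle, hw⟩ h1 h11
    refine (steps_relaxAll h1 (hG.of_frame hf) hs₁).mono le_rfl ?_
    rintro s₂ ⟨hf₂, hs₂, hle₂, hadj₂⟩
    refine ⟨(hf₂.1 1 (by norm_num)).trans h1, (hf₂.1 11 (by norm_num)).trans h11,
      (hf.trans (hf₂.mono (by norm_num))).set le_rfl _, hs₂,
      fun u => (hle u).trans (hle₂ u), fun u p hp => ?_⟩
    cases p with
    | nil =>
      have h2 := hle v
      have h3 := hle₂ v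
      simp only [State.set_arr, SimpleGraph.Walk.length_nil]
      omega
    | @cons _ w _ h p =>
      simp only [SimpleGraph.Walk.length_cons] at hp ⊢
      have h2 := hw w p (by omega)
      have h3 := hadj₂ w u h.symm
      simp only [State.set_arr]
      omega
  · rintro s' ⟨-, hf, h, h', h''⟩
    refine ⟨hf, h, ?_⟩
    intro x hx u p
    rcases List.mem_cons.1 hx with rfl | hx
    · by_cases hp : p.length ≤ n
      · exact h'' u p hp
      -- A walk longer than `n ≥ a * L` satisfies the inequality whatever the array holds.
      · simp only; omega
    · exact (hc x hx u p).trans (by have := h' u; omega)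

end RAM

namespace RAM

variable {ω : ℕ → Bool} {s : State} {Q : State → Prop} {n : ℕ} {G : SimpleGraph (Fin n)}

/-! ### The algorithm as a coin tossing computation -/

/-- A uniformly random number below `2 ^ m`. -/
def sample (m : ℕ) : CoinTree ℕ :=
  .iter (fun _ a => .toss fun x => .ret (a + a + x.toNat)) m 0

open Classical in
/-- If the vertex `i` is not covered, place a ball of random radius there. -/
noncomputable def visit (G : SimpleGraph (Fin n)) (m L i : ℕ) (l : List (Fin n × ℕ)) :
    CoinTree (List (Fin n × ℕ)) :=
  if h : i < n then
    if Covered G L l ⟨i, h⟩ then .ret l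
    else (sample m).bind fun a => .ret ((⟨i, h⟩, a) :: l)
  else .ret l

/-- Some class of radii is used more than `L` times. -/
def Overfull (K L : ℕ) (l : List (Fin n × ℕ)) : Prop :=
  ∃ a < K, L < (l.map Prod.snd).count a

open Classical in
/-- One attempt at covering the graph with balls of radii below `2 ^ m * L`. -/
noncomputable def attempt (G : SimpleGraph (Fin n)) (m L r : ℕ) : CoinTree ℕ :=
  (CoinTree.iter (visit G m L) n []).bind fun l =>
    .ret (if Overfull (2 ^ m) L l then r else min r (2 ^ m * L))

/-- The approximation algorithm: `n` attempts for each choice of the parameters. -/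
noncomputable def approximate (G : SimpleGraph (Fin n)) : CoinTree ℕ :=
  .iter (fun m => .iter (fun j => .iter (fun _ => attempt G m (j + 1)) n) (n / 2 ^ m)) n.size n

/-! ### The program

Registers: `0` is the best solution, `1` is `n`, `2` is `2 ^ m`, `3` is `2 ^ m * L`, `4` is `L`,
`5` counts the attempts, `6` is nonzero if the present attempt has failed, `7` is the vertex to be
visited, `8` is the random radius, and the others are auxiliary. Array `1` holds for each vertex
the residual radius plus one of the balls that contain it, array `2` the number of uses of each
radius. -/

def sampleProg : Prog :=
  .seq (.assign 8 (.const 0)) (.seq (.assign 9 (.const 1)) (.loop (.sub (.reg 2) (.reg 9))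
    (.seq (.toss 10) (.seq (.assign 8 (.add (.reg 8) (.reg 8)))
      (.seq (.cond (.reg 10) (.assign 8 (.add (.reg 8) (.reg 4))) .skip)
        (.assign 9 (.add (.reg 9) (.reg 9))))))))

def visitProg : Prog :=
  .cond (.read 1 (.reg 7)) .skip (.seq sampleProg
    (.seq (.write 2 (.reg 8) (.add (.read 2 (.reg 8)) (.const 1)))
      (.seq (.assign 6 (.add (.reg 6) (.sub (.read 2 (.reg 8)) (.reg 4))))
        (.seq (.write 1 (.reg 7) (.add (.reg 8) (.const 1))) propagate))))

def clearProg : Prog :=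
  forLoop 7 (.seq (.write 1 (.reg 7) (.const 0)) (.write 2 (.reg 7) (.const 0)))

def attemptProg : Prog :=
  .seq clearProg (.seq (.assign 6 (.const 0)) (.seq (forLoop 7 visitProg)
    (.cond (.reg 6) .skip (.assign 0 (.sub (.reg 0) (.sub (.reg 0) (.reg 3)))))))

def scaleProg : Prog :=
  .seq (.assign 3 (.reg 2)) (.seq (.assign 4 (.const 1))
    (.loop (.sub (.add (.reg 1) (.const 1)) (.reg 3)) (.seq (forLoop 5 attemptProg)
      (.seq (.assign 3 (.add (.reg 3) (.reg 2))) (.assign 4 (.add (.reg 4) (.const 1)))))))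

def approximateProg : Prog :=
  .seq (.assign 1 (.reg 0)) (.seq (.assign 2 (.const 1))
    (.loop (.sub (.add (.reg 1) (.const 1)) (.reg 2))
      (.seq scaleProg (.assign 2 (.add (.reg 2) (.reg 2))))))

/-! ### The program computes `approximate` in polynomial time. -/

theorem run_iter_succ {α : Type*} (f : ℕ → α → CoinTree α) (k : ℕ) (a : α) (pos : ℕ) :
    (CoinTree.iter f (k + 1) a).run ω pos =
      (f k ((CoinTree.iter f k a).run ω pos).1).run ω ((CoinTree.iter f k a).run ω pos).2 :=
  CoinTree.run_bind ..

theorem all_sample (m : ℕ) : (sample m).All (· < 2 ^ m) := by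
  refine CoinTree.all_iter (Q := fun i a => a < 2 ^ i) ?_ (by norm_num)
  intro i _ a ha x
  show a + a + x.toNat < 2 ^ (i + 1)
  have := x.toNat_le
  rw [pow_succ]; omega

/-- Without multiplication, `a * L` is built directly: double the accumulator and add `L` instead of
`1` for each set bit. -/
theorem steps_sampleProg {m L : ℕ} (h2 : s.reg 2 = 2 ^ m) (h4 : s.reg 4 = L) :
    Steps ω sampleProg s (m * 19 + 8) fun s' => (∀ x < 8, s'.reg x = s.reg x) ∧
      s'.arr = s.arr ∧ ∃ a, s'.reg 8 = a * L ∧ (a, s'.coins) = (sample m).run ω s.coins := by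
  refine Steps.le (Steps.seq (Steps.assign (Steps.seq (Steps.assign (Steps.mono
    (Steps.loop (c := 15) (N := m) (I := fun i s' => (∀ x < 8, s'.reg x = s.reg x) ∧
      s'.arr = s.arr ∧ s'.reg 9 = 2 ^ i ∧ ∃ a, s'.reg 8 = a * L ∧ (a, s'.coins) = (CoinTree.iter
        (fun _ a => .toss fun x => .ret (a + a + x.toNat)) i 0).run ω s.coins)
      ?_ ?_ ?_) le_rfl ?_))))) (le_of_eq (by simp only [Exp.cost]; ring))
  · refine ⟨?_, rfl, by simp [Exp.eval], 0, by simp [Exp.eval], rfl⟩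
    intro x hx
    simp only [Function.update_apply]
    rw [if_neg (by omega), if_neg (by omega)]
  · rintro i hi s₁ ⟨hr, ha, h9, a, h8, hrun⟩
    have h2' := hr 2 (by norm_num)
    have h4' := hr 4 (by norm_num)
    refine ⟨?_, ?_⟩
    · have : 2 ^ i < 2 ^ m := Nat.pow_lt_pow_right (by norm_num) hi
      simp [Exp.eval, h2', h2, h9]; omega
    · refine Steps.le (Steps.seq (Steps.toss (Steps.seq (Steps.assign
        (Steps.seq (Steps.cond (T := 4) ?_ ?_)))))) (T := 1 + (4 + (6 + 4)))
        (by norm_num)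
      all_goals
        intro he
        simp only [Exp.eval, Function.update_apply] at he
        norm_num at he
      · refine Steps.assign (Steps.assign ⟨?_, ha, ?_, a + a + 1, ?_, ?_⟩)
        · intro x hx
          simp only [Function.update_apply]
          rw [if_neg (by omega), if_neg (by omega), if_neg (by omega), if_neg (by omega), hr x hx]
        · simp [Exp.eval, h9, pow_succ]; ring
        · simp [Exp.eval, h8, h4', h4]; ring
        · rw [run_iter_succ, ← hrun]; simp [CoinTree.run, he]
      · refine Steps.le (T := 1) (Steps.skip (Steps.assign ⟨?_, ha, ?_, a + a, ?_, ?_⟩))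
          (by norm_num)
        · intro x hx
          simp only [Function.update_apply]
          rw [if_neg (by omega), if_neg (by omega), if_neg (by omega), hr x hx]
        · simp [Exp.eval, h9, pow_succ]; ring
        · simp [Exp.eval, h8]; ring
        · rw [run_iter_succ, ← hrun]; simp [CoinTree.run, he]
  · rintro s' ⟨hr, -, h9, -⟩
    simp [Exp.eval, h9, hr 2 (by norm_num), h2]
  · rintro s' ⟨hr, ha, -, h⟩
    refine ⟨hr, ha, h⟩

/-- The configuration represents the list of balls placed so far. -/
structure Represents (G : SimpleGraph (Fin n)) (m L : ℕ) (l : List (Fin n × ℕ)) (s : State) :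
    Prop where
  sound : Sound G L l (s.arr 1)
  complete : Complete G L l (s.arr 1)
  count : ∀ a < 2 ^ m, s.arr 2 (a * L) = (l.map Prod.snd).count a
  bad : s.reg 6 = 0 ↔ ¬ Overfull (2 ^ m) L l

theorem overfull_cons {K L : ℕ} {l : List (Fin n × ℕ)} {v : Fin n} {a : ℕ} (ha : a < K) :
    Overfull K L ((v, a) :: l) ↔ Overfull K L l ∨ L < (l.map Prod.snd).count a + 1 := by
  simp only [Overfull, List.map_cons, List.count_cons]
  constructor
  · rintro ⟨a', h, h'⟩
    by_cases he : a = a'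
    · subst he; right; simpa using h'
    · left; exact ⟨a', h, by simpa [he] using h'⟩
  · rintro (⟨a', h, h'⟩ | h)
    · exact ⟨a', h, h'.trans_le (Nat.le_add_right _ _)⟩
    · exact ⟨a, ha, by simpa using h⟩

theorem steps_visitProg {m L : ℕ} {l : List (Fin n × ℕ)} {i : ℕ} (hL : 0 < L) (hm : m ≤ n)
    (hmL : 2 ^ m * L ≤ n) (hi : i < n) (h1 : s.reg 1 = n) (h2 : s.reg 2 = 2 ^ m)
    (h4 : s.reg 4 = L) (h7 : s.reg 7 = i) (hG : HasGraph G s) (hl : Represents G m L l s) :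
    Steps ω visitProg s (n * (n * (n * 27 + 14) + 35) + 35) fun s' =>
      (∀ x < 6, s'.reg x = s.reg x) ∧ s'.reg 7 = i ∧ s'.arr 0 = s.arr 0 ∧
      ∃ l', Represents G m L l' s' ∧ (l', s'.coins) = (visit G m L i l).run ω s.coins := by
  refine Steps.le (Steps.cond (T := (m * 19 + 8) + (6 + (7 + (5 +
    (n * (n * (n * 27 + 14) + 16) + 6))))) ?_ ?_) ?_
  · intro he
    have hc : Covered G L l ⟨i, hi⟩ := by
      rw [← covered_iff hl.sound hl.complete]
      simpa [Exp.eval, h7] using he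
    refine Steps.le (T := 1) (Steps.skip ⟨fun _ _ => rfl, h7, rfl, l, hl, ?_⟩) (by omega)
    simp [visit, hi, hc, CoinTree.run]
  · intro he
    have he' : s.arr 1 i = 0 := by simpa [Exp.eval, h7] using he
    have hc : ¬ Covered G L l ⟨i, hi⟩ := by
      rw [← covered_iff hl.sound hl.complete]
      simpa using he'
    refine Steps.seq ((steps_sampleProg h2 h4).mono le_rfl ?_)
    rintro s₁ ⟨hr, harr, a, h8, hrun⟩
    have ha : a < 2 ^ m := by
      have := (all_sample m).run ω s.coins
      rwa [← hrun] at this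
    have haL : a * L ≤ n := (Nat.mul_le_mul_right L ha.le).trans hmL
    refine Steps.seq (Steps.write (Steps.seq (Steps.assign (Steps.seq (Steps.write
      (Steps.mono (steps_propagate (G := G) (L := L) (a := a) (l := l) (v := ⟨i, hi⟩)
        ?_ ?_ ?_ ?_ ?_ haL) le_rfl ?_))))))
    · simp [hr, h1]
    · intro i j
      simpa [Function.update_apply, harr] using hG i j
    · intro v hv
      by_cases hvi : (v : ℕ) = i
      · have hv' : v = ⟨i, hi⟩ := Fin.ext hvi
        subst hv'
        refine ⟨_, List.mem_cons_self, .nil, ?_⟩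
        simp [Exp.eval, hr, h7, h8]
      · simp only [Exp.eval, Function.update_apply, hr 7 (by norm_num), h7, harr] at hv ⊢
        simp only [if_true] at hv ⊢
        obtain ⟨x, hx, p, hp⟩ := hl.sound v (by simpa [hvi, hr, h7] using hv)
        exact ⟨x, List.mem_cons_of_mem _ hx, p, by simpa [hvi, hr, h7] using hp⟩
    · intro x hx v p
      refine (hl.complete x hx v p).trans (Nat.add_le_add_left ?_ _)
      by_cases hvi : (v : ℕ) = i
      -- The overwritten entry was `0`, so the older balls lose nothing.
      · rw [hvi, he']; exact Nat.zero_le _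
      · simp [Exp.eval, hr, h7, hvi, harr]
    · simp [Exp.eval, hr, h7, h8]
    · rintro s₂ ⟨hf, hs, hc'⟩
      have h20 : s₂.arr 0 = s.arr 0 := by
        rw [hf.2.1 0 (by norm_num)]; simp [harr]
      -- Class `a` is counted at index `a * L`, the only form in which the machine knows it; `0 < L`
      -- keeps these indices distinct.
      have h22 : s₂.arr 2 = Function.update (s.arr 2) (a * L) (s.arr 2 (a * L) + 1) := by
        rw [hf.2.1 2 (by norm_num)]
        simp [Exp.eval, harr, h8]
      -- By truncation, the failure flag grows only when the new count exceeds `L`.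
      have h26 : s₂.reg 6 = s.reg 6 + (s.arr 2 (a * L) + 1 - L) := by
        rw [hf.1 6 (by norm_num)]
        simp [Exp.eval, harr, h8, hr, h4]
      refine ⟨?_, ?_, h20, (⟨i, hi⟩, a) :: l, ⟨hs, hc', ?_, ?_⟩, ?_⟩
      · intro x hx
        rw [hf.1 x (by omega)]
        simp only [Function.update_apply]
        rw [if_neg (by omega), hr x (by omega)]
      · rw [hf.1 7 (by norm_num)]
        simp [hr, h7]
      · intro a' ha'
        rw [h22, Function.update_apply, List.map_cons, List.count_cons]
        have h := hl.count a' ha'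
        by_cases hE : a = a'
        · subst hE; simp [h]
        · have : a' * L ≠ a * L := fun h => hE (Nat.eq_of_mul_eq_mul_right hL h).symm
          simp [this, hE, h]
      · rw [h26, hl.count a ha, overfull_cons ha, not_or, ← hl.bad]
        omega
      · simp only [visit, hi, hc, dif_pos, if_false, CoinTree.run_bind, ← hrun, CoinTree.run]
        rw [hf.2.2]
  · simp only [Exp.cost]
    nlinarith

theorem steps_clearProg (h1 : s.reg 1 = n) :
    Steps ω clearProg s (n * 14 + 6) fun s' =>
      (∀ x < 7, s'.reg x = s.reg x) ∧ s'.arr 0 = s.arr 0 ∧ s'.coins = s.coins ∧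
      ∀ i < n, s'.arr 1 i = 0 ∧ s'.arr 2 i = 0 := by
  refine (Steps.forLoop (c := 6) (n := n) (I := fun k s' =>
      (∀ x < 7, s'.reg x = s.reg x) ∧ s'.arr 0 = s.arr 0 ∧ s'.coins = s.coins ∧
      ∀ i < k, s'.arr 1 i = 0 ∧ s'.arr 2 i = 0) (by norm_num) h1 ?_ ?_).mono le_rfl
      fun s' h => h.2
  · refine ⟨fun x hx => ?_, rfl, rfl, fun i hi => by omega⟩
    rw [State.set_reg, if_neg (by omega)]
  · rintro k hk s' ⟨hr, h0, hc, ha⟩ h1 h7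
    refine Steps.seq (T := 3) (T' := 3) (Steps.write (Steps.write ⟨h1, h7, ?_, ?_, hc, ?_⟩))
    · intro x hx
      rw [State.set_reg, if_neg (by omega)]; exact hr x hx
    · simpa [Function.update_apply] using h0
    · intro i hi
      simp only [State.set_arr, Function.update_apply, Exp.eval, h7]
      by_cases hik : i = k
      · simp [hik]
      · simpa [hik] using ha i (by omega)

theorem steps_attemptProg {m L r : ℕ} (hL : 0 < L) (hm : m ≤ n)
    (hmL : 2 ^ m * L ≤ n) (h0 : s.reg 0 = r) (h1 : s.reg 1 = n) (h2 : s.reg 2 = 2 ^ m)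
    (h3 : s.reg 3 = 2 ^ m * L) (h4 : s.reg 4 = L) (hG : HasGraph G s) :
    Steps ω attemptProg s (n * (n * (n * (n * 27 + 14) + 35) + 57) + 22) fun s' =>
      (∀ x < 6, 0 < x → s'.reg x = s.reg x) ∧ s'.arr 0 = s.arr 0 ∧
      (s'.reg 0, s'.coins) = (attempt G m L r).run ω s.coins := by
  refine Steps.le (T := (n * 14 + 6) + (2 + ((n * ((n * (n * (n * 27 + 14) + 35) + 35) + 8) + 6) +
    (2 + 6)))) ?_ (le_of_eq (by ring))
  refine Steps.seq ((steps_clearProg h1).mono le_rfl ?_)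
  rintro s₁ ⟨hr, ha0, hcoins, hz⟩
  refine Steps.seq (Steps.assign (Steps.seq (Steps.mono (Steps.forLoop
    (c := n * (n * (n * 27 + 14) + 35) + 35) (n := n) (I := fun k s' =>
      (∀ x < 6, s'.reg x = s.reg x) ∧ s'.arr 0 = s.arr 0 ∧
      ∃ l, Represents G m L l s' ∧
        (l, s'.coins) = (CoinTree.iter (visit G m L) k []).run ω s.coins) (by norm_num)
    ?_ ?_ ?_) le_rfl ?_)))
  · simp [hr, h1]
  · refine ⟨?_, ha0, [], ⟨?_, ?_, ?_, ?_⟩, ?_⟩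
    · intro x hx
      simp only [State.set, Function.update_apply]
      rw [if_neg (by omega), if_neg (by omega), hr x (by omega)]
    · intro v hv
      exact absurd (hz v v.2).1 hv
    · intro x hx
      simp at hx
    · intro a ha
      refine (hz _ ?_).2
      exact (Nat.mul_lt_mul_of_pos_right ha hL).trans_le hmL
    · simp [State.set_reg, Exp.eval, Overfull]
    · simp [CoinTree.iter, CoinTree.run, hcoins]
  · rintro k hk s₂ ⟨hr₂, ha₂, l, hl, hrun⟩ h1' h7
    refine (steps_visitProg (G := G) hL hm hmL hk h1' ((hr₂ 2 (by norm_num)).trans h2)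
      ((hr₂ 4 (by norm_num)).trans h4) h7 (fun i j => by rw [ha₂]; exact hG i j) hl).mono
      le_rfl ?_
    rintro s₃ ⟨hr₃, h7', ha₃, l', hl', hrun'⟩
    refine ⟨(hr₃ 1 (by norm_num)).trans h1', h7', ?_, ha₃.trans ha₂, l',
      ⟨hl'.sound, hl'.complete, hl'.count, ?_⟩, ?_⟩
    · intro x hx
      rw [State.set_reg, if_neg (by omega), hr₃ x hx, hr₂ x hx]
    · rw [State.set_reg, if_neg (by norm_num)]; exact hl'.bad
    · rw [run_iter_succ, ← hrun]; exact hrun'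
  · rintro s₂ ⟨-, hr₂, ha₂, l, hl, hrun⟩
    refine Steps.cond (T := 6) ?_ ?_
    · intro he
      have hb : Overfull (2 ^ m) L l := by
        by_contra h
        exact he (hl.bad.2 h)
      refine Steps.le (T := 1) (Steps.skip ⟨fun x hx _ => hr₂ x hx, ha₂, ?_⟩) (by norm_num)
      simp [attempt, CoinTree.run_bind, ← hrun, CoinTree.run, hb, hr₂, h0]
    · intro he
      have hb : ¬ Overfull (2 ^ m) L l := hl.bad.1 he
      refine Steps.assign ⟨fun x hx h => ?_, ha₂, ?_⟩
      · rw [← hr₂ x hx]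
        simp [h.ne']
      -- With truncated subtraction, `r - (r - R)` is `min r R`.
      · simp only [attempt, CoinTree.run_bind, ← hrun, CoinTree.run, hb, if_false]
        simp [Exp.eval, hr₂, h0, h3]
        omega

theorem steps_scaleProg {m r : ℕ} (hm : m ≤ n) (h0 : s.reg 0 = r) (h1 : s.reg 1 = n)
    (h2 : s.reg 2 = 2 ^ m) (hG : HasGraph G s) :
    Steps ω scaleProg s
      (n * ((n * (n * (n * (n * (n * 27 + 14) + 35) + 57) + 30) + 6) + 14) + 10) fun s' =>
      s'.reg 1 = n ∧ s'.reg 2 = 2 ^ m ∧ HasGraph G s' ∧ (s'.reg 0, s'.coins) =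
        (CoinTree.iter (fun j => .iter (fun _ => attempt G m (j + 1)) n) (n / 2 ^ m) r).run ω
          s.coins := by
  refine Steps.le (Steps.seq (Steps.assign (Steps.seq (Steps.assign (Steps.mono (Steps.loop
    (N := n / 2 ^ m) (c := (n * (n * (n * (n * (n * 27 + 14) + 35) + 57) + 22 + 8) + 6) + (4 + 4))
    (I := fun j s' => s'.reg 1 = n ∧ s'.reg 2 = 2 ^ m ∧ s'.reg 3 = 2 ^ m * (j + 1) ∧
      s'.reg 4 = j + 1 ∧ HasGraph G s' ∧ (s'.reg 0, s'.coins) =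
        (CoinTree.iter (fun j => .iter (fun _ => attempt G m (j + 1)) n) j r).run ω s.coins)
    ?_ ?_ ?_) le_rfl ?_))))) ?_
  · exact ⟨by simpa using h1, by simpa using h2, by simpa [Exp.eval] using h2, by simp [Exp.eval],
      hG, by simp [CoinTree.iter, CoinTree.run, h0]⟩
  · rintro j hj s₁ ⟨h1', h2', h3, h4, hG', hrun⟩
    have hle : 2 ^ m * (j + 1) ≤ n := by
      rw [mul_comm]
      exact (Nat.le_div_iff_mul_le (by positivity)).1 hj
    refine ⟨by simp [Exp.eval, h1', h3]; omega, Steps.seq ?_⟩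
    refine (Steps.forLoop (c := n * (n * (n * (n * 27 + 14) + 35) + 57) + 22) (n := n)
      (I := fun k s' => (∀ x < 5, 0 < x → s'.reg x = s₁.reg x) ∧ s'.arr 0 = s₁.arr 0 ∧
        (s'.reg 0, s'.coins) =
          (CoinTree.iter (fun _ => attempt G m (j + 1)) k (s₁.reg 0)).run ω s₁.coins)
      (by norm_num) h1' ?_ ?_).mono le_rfl ?_
    · refine ⟨fun x hx _ => ?_, rfl, by simp [CoinTree.iter, CoinTree.run, State.set_reg]⟩
      rw [State.set_reg, if_neg (by omega)]
    · rintro k hk s₂ ⟨hr, ha, hrun₂⟩ h1₂ h5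
      refine (steps_attemptProg (G := G) (m := m) (Nat.succ_pos j) hm hle rfl h1₂
        ((hr 2 (by norm_num) (by norm_num)).trans h2')
        ((hr 3 (by norm_num) (by norm_num)).trans h3)
        ((hr 4 (by norm_num) (by norm_num)).trans h4)
        (fun i j => by rw [ha]; exact hG' i j)).mono le_rfl ?_
      rintro s₃ ⟨hr₃, ha₃, hrun₃⟩
      refine ⟨(hr₃ 1 (by norm_num) (by norm_num)).trans h1₂,
        (hr₃ 5 (by norm_num) (by norm_num)).trans h5, fun x hx h => ?_, ha₃.trans ha, ?_⟩
      · rw [State.set_reg, if_neg (by omega), hr₃ x (by omega) h, hr x hx h]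
      · rw [run_iter_succ, ← hrun₂, ← hrun₃]
        simp [State.set_reg]
    · rintro s₂ ⟨h1₂, hr, ha, hrun₂⟩
      refine Steps.seq (Steps.assign (Steps.assign ⟨?_, ?_, ?_, ?_, ?_, ?_⟩))
      · simpa using h1₂
      · simp [hr, h2']
      · simp [Exp.eval, hr, h2', h3]; ring
      · simp [Exp.eval, hr, h4]
      · exact fun i j => by
          rw [← hG']; simp [ha]
      · rw [run_iter_succ, ← hrun, ← hrun₂]
        simp
  · rintro s' ⟨h1', h2', h3, -⟩
    have := Nat.lt_mul_div_succ n (show 0 < 2 ^ m by positivity)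
    simp [Exp.eval, h1', h3]; omega
  · rintro s' ⟨h1', h2', -, -, hG', hrun⟩
    exact ⟨h1', h2', hG', hrun⟩
  · have := Nat.mul_le_mul_right ((n * (n * (n * (n * (n * 27 + 14) + 35) + 57) + 30) + 6) + 14)
      (Nat.div_le_self n (2 ^ m))
    simp only [Exp.cost]
    ring_nf at this ⊢
    omega

theorem steps_approximateProg (G : SimpleGraph (Fin n)) :
    Steps ω approximateProg (init G)
      (n * (n * ((n * (n * (n * (n * (n * 27 + 14) + 35) + 57) + 30) + 6) + 14) + 20) + 10)
      fun s' => s'.reg 0 = ((approximate G).run ω 0).1 := by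
  have hsize : n.size ≤ n := Nat.size_le.2 n.lt_two_pow_self
  refine Steps.le (Steps.seq (Steps.assign (Steps.seq (Steps.assign (Steps.mono (Steps.loop
    (N := n.size) (c := (n * ((n * (n * (n * (n * (n * 27 + 14) + 35) + 57) + 30) + 6) + 14) + 10) +
      4)
    (I := fun m s' => s'.reg 1 = n ∧ s'.reg 2 = 2 ^ m ∧ HasGraph G s' ∧ (s'.reg 0, s'.coins) =
        (CoinTree.iter (fun m => .iter (fun j => .iter (fun _ => attempt G m (j + 1)) n)
          (n / 2 ^ m)) m n).run ω 0)
    ?_ ?_ ?_) le_rfl ?_))))) ?_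
  · exact ⟨by simp [Exp.eval, init], by simp [Exp.eval], hasGraph_init G,
      by simp [CoinTree.iter, CoinTree.run, init]⟩
  · rintro m hm s₁ ⟨h1, h2, hG, hrun⟩
    have hlt : 2 ^ m ≤ n := Nat.lt_size.1 hm
    refine ⟨by simp [Exp.eval, h1, h2]; omega, Steps.seq ?_⟩
    refine (steps_scaleProg (hm.le.trans hsize) rfl h1 h2 hG).mono le_rfl ?_
    rintro s₂ ⟨h1', h2', hG', hrun'⟩
    refine Steps.assign ⟨by simpa using h1', by simp [Exp.eval, h2', pow_succ]; ring, hG', ?_⟩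
    rw [run_iter_succ, ← hrun, ← hrun']
    simp
  · rintro s' ⟨h1, h2, -⟩
    have : n < 2 ^ n.size := Nat.lt_size_self n
    simp [Exp.eval, h1, h2]; omega
  · rintro s' ⟨-, -, -, hrun⟩
    rw [approximate, ← hrun]
  · have := Nat.mul_le_mul_right
      ((n * ((n * (n * (n * (n * (n * 27 + 14) + 35) + 57) + 30) + 6) + 14) + 20)) hsize
    simp only [Exp.cost]
    ring_nf at this ⊢
    omega

theorem isRandomizedPolyTime_approximate :
    IsRandomizedPolyTime fun _ G ω => ((approximate G).run ω 0).1 := by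
  refine ⟨approximateProg, .X * (.X * ((.X * (.X * (.X * (.X * (.X * 27 + 14) + 35) + 57) + 30)
    + 6) + 14) + 20) + 10, fun n G ω => ?_⟩
  obtain ⟨s, t, h, ht, hs⟩ := steps_approximateProg (ω := ω) G
  exact ⟨s, t, h, by simpa using ht, hs⟩

end RAM

/-! ### Validity of the output. -/

namespace RAM

variable {n : ℕ} {G : SimpleGraph (Fin n)}

theorem near_iff {r : ℕ} {u v : Fin n} : Near G r u v ↔ G.edist u v ≤ r := by
  rw [SimpleGraph.edist_comm]
  constructor
  · rintro ⟨p, hp⟩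
    exact (SimpleGraph.edist_le p).trans (by exact_mod_cast hp)
  · intro h
    have hr : G.Reachable v u := SimpleGraph.edist_ne_top_iff_reachable.1
      (h.trans_lt (ENat.natCast_lt_top r)).ne
    obtain ⟨p, hp⟩ := hr.exists_walk_length_eq_edist
    exact ⟨p, by rw [← hp] at h; exact_mod_cast h⟩

theorem burningNumber_le_card (G : SimpleGraph (Fin n)) : burningNumber G ≤ n :=
  Nat.sInf_le ⟨id, fun v => ⟨v, by simp⟩⟩

theorem exists_cover (G : SimpleGraph (Fin n)) : ∃ c : Fin (burningNumber G) → Fin n,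
    ∀ v, ∃ i : Fin (burningNumber G), Near G i (c i) v := by
  have : ∃ c : Fin (burningNumber G) → Fin n, ∀ v : Fin n, ∃ i : Fin (burningNumber G),
      G.edist (c i) v ≤ ((i : ℕ) : ℕ∞) :=
    Nat.sInf_mem (s := {b : ℕ | ∃ c : Fin b → Fin n, ∀ v : Fin n, ∃ i : Fin b,
      G.edist (c i) v ≤ ((i : ℕ) : ℕ∞)}) ⟨n, id, fun v => ⟨v, by simp⟩⟩
  simpa only [near_iff] using this

theorem burningNumber_pos (hn : 0 < n) (G : SimpleGraph (Fin n)) : 0 < burningNumber G := by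
  obtain ⟨c, hc⟩ := exists_cover G
  obtain ⟨i, -⟩ := hc ⟨0, hn⟩
  exact i.pos

/-- The `j`-th ball of class `a` receives the radius `a * L + j`, which is at least its own radius
`a * L`; there is room because `j < L`. -/
theorem burningNumber_le_of_covered {K L : ℕ} {l : List (Fin n × ℕ)} (hL : 0 < L)
    (hK : ∀ x ∈ l, x.2 < K) (hc : ∀ v, Covered G L l v) (ho : ¬ Overfull K L l) :
    burningNumber G ≤ K * L := by
  rcases n.eq_zero_or_pos with rfl | hn
  · exact (burningNumber_le_card G).trans (Nat.zero_le _)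
  -- Radii that no ball of the list uses get the arbitrary centre `0`.
  refine Nat.sInf_le ⟨fun i => ((l.filter fun x => x.2 = i / L)[(i : ℕ) % L]?.getD (⟨0, hn⟩, 0)).1,
    fun v => ?_⟩
  obtain ⟨x, hx, hv⟩ := hc v
  have hxf : x ∈ l.filter fun y => y.2 = x.2 := by simp [hx]
  obtain ⟨j, hj, hjx⟩ := List.getElem_of_mem hxf
  have hlen : (l.filter fun y => y.2 = x.2).length ≤ L := by
    have h : ¬ L < (l.map Prod.snd).count x.2 := fun h => ho ⟨x.2, hK x hx, h⟩
    rw [List.count, List.countP_map, List.countP_eq_length_filter] at h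
    exact not_lt.1 h
  have hjL : j < L := hj.trans_le hlen
  have hlt : x.2 * L + j < K * L := by
    have := Nat.mul_le_mul_right L (hK x hx)
    rw [Nat.succ_mul] at this
    omega
  refine ⟨⟨x.2 * L + j, hlt⟩, ?_⟩
  have h1 : (x.2 * L + j) / L = x.2 := by
    rw [mul_comm, Nat.mul_add_div hL, Nat.div_eq_of_lt hjL, add_zero]
  have h2 : (x.2 * L + j) % L = j := by
    rw [mul_comm, Nat.mul_add_mod, Nat.mod_eq_of_lt hjL]
  simp only [h1, h2, List.getElem?_eq_getElem hj, hjx, Option.getD_some]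
  exact (near_iff.1 hv).trans (by exact_mod_cast Nat.le_add_right _ _)

theorem Covered.cons {L : ℕ} {l : List (Fin n × ℕ)} {v : Fin n} (h : Covered G L l v)
    (x : Fin n × ℕ) : Covered G L (x :: l) v := by
  obtain ⟨y, hy, h⟩ := h
  exact ⟨y, List.mem_cons_of_mem _ hy, h⟩

theorem all_attempt {m L r : ℕ} (hL : 0 < L) (hr : burningNumber G ≤ r) :
    (attempt G m L r).All (burningNumber G ≤ ·) := by
  refine (CoinTree.all_iter (Q := fun k l => (∀ x ∈ l, x.2 < 2 ^ m) ∧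
    ∀ v : Fin n, (v : ℕ) < k → Covered G L l v) ?_ ⟨by simp, by simp⟩).bind ?_
  · rintro i hi l ⟨h1, h2⟩
    rw [visit, dif_pos hi]
    split_ifs with hc
    · refine ⟨h1, fun v hv => ?_⟩
      rcases Nat.lt_succ_iff_lt_or_eq.1 hv with h | rfl
      · exact h2 v h
      · exact hc
    · refine (all_sample m).bind fun a ha => ⟨?_, fun v hv => ?_⟩
      · intro x hx
        rcases List.mem_cons.1 hx with rfl | hx
        · exact ha
        · exact h1 x hx
      · rcases Nat.lt_succ_iff_lt_or_eq.1 hv with h | rfl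
        · exact (h2 v h).cons _
        · exact ⟨_, List.mem_cons_self, .nil, Nat.zero_le _⟩
  · rintro l ⟨h1, h2⟩
    simp only [CoinTree.All]
    split_ifs with ho
    · exact hr
    · exact le_min hr (burningNumber_le_of_covered hL h1 (fun v => h2 v v.2) ho)

theorem all_approximate (G : SimpleGraph (Fin n)) :
    (approximate G).All (burningNumber G ≤ ·) :=
  CoinTree.all_iter (Q := fun _ r => burningNumber G ≤ r)
    (fun _ _ _ hr => CoinTree.all_iter (Q := fun _ r => burningNumber G ≤ r)
      (fun _ _ _ hr => CoinTree.all_iter (Q := fun _ r => burningNumber G ≤ r)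
        (fun _ _ _ hr => all_attempt (Nat.succ_pos _) hr) hr) hr) (burningNumber_le_card G)

theorem sum_range_two_mul (g : ℕ → ℝ) (M : ℕ) :
    ∑ a ∈ Finset.range (2 * M), g a = ∑ a ∈ Finset.range M, (g (2 * a) + g (2 * a + 1)) := by
  induction M with
  | zero => simp
  | succ M ih =>
    rw [show 2 * (M + 1) = 2 * M + 1 + 1 by ring, Finset.sum_range_succ, Finset.sum_range_succ, ih,
      Finset.sum_range_succ]
    ring

theorem expect_sample (m : ℕ) (g : ℕ → ℝ) :
    (sample m).expect g = (∑ a ∈ Finset.range (2 ^ m), g a) / 2 ^ m := by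
  unfold sample
  induction m generalizing g with
  | zero => simp [CoinTree.iter, CoinTree.expect]
  | succ m ih =>
    rw [CoinTree.iter, CoinTree.expect_bind, ih, pow_succ', sum_range_two_mul, pow_succ',
      mul_comm (2 : ℝ), ← div_div, Finset.sum_div, Finset.sum_div, Finset.sum_div]
    refine Finset.sum_congr rfl fun a _ => ?_
    simp only [CoinTree.expect, Bool.toNat_false, Bool.toNat_true, add_zero, two_mul]
    ring

/-! ### The analysis of one attempt -/

section Potential

variable {b : ℕ} (ι : Fin n → Fin b) (w : Fin b → ℝ)

open Classical in
/-- The total weight of the balls of the cover `ι` that still contain uncovered vertices. -/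
noncomputable def weight (G : SimpleGraph (Fin n)) (L : ℕ) (l : List (Fin n × ℕ)) : ℝ :=
  ∑ i, if ∃ v, ι v = i ∧ ¬ Covered G L l v then w i else 0

/-- A supermartingale that bounds the probability of failure. -/
noncomputable def potential (G : SimpleGraph (Fin n)) (K L : ℕ) (T D : ℝ)
    (l : List (Fin n × ℕ)) : ℝ :=
  (weight ι w G L l + l.length) / T + ∑ a ∈ Finset.range K,
    (((l.map Prod.snd).count a - l.length / K : ℝ) ^ 2 + (T - l.length) / K) / D ^ 2

variable {ι w}

theorem weight_nonneg (hw : ∀ i, 0 ≤ w i) (L : ℕ) (l : List (Fin n × ℕ)) :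
    0 ≤ weight ι w G L l :=
  Finset.sum_nonneg fun i _ => by split_ifs <;> simp [hw]

theorem le_weight (hw : ∀ i, 0 ≤ w i) {L : ℕ} {l : List (Fin n × ℕ)} {v : Fin n}
    (hv : ¬ Covered G L l v) : w (ι v) ≤ weight ι w G L l := by
  classical
  refine le_trans ?_ (Finset.single_le_sum (fun i _ => by split_ifs <;> simp [hw])
    (Finset.mem_univ (ι v)))
  rw [if_pos ⟨v, rfl, hv⟩]

theorem weight_nil_le (hw : ∀ i, 0 ≤ w i) (L : ℕ) : weight ι w G L [] ≤ ∑ i, w i :=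
  Finset.sum_le_sum fun i _ => by split_ifs <;> simp [hw]

/-- Through the optimal centre, any two vertices of the optimal ball `i` are within `2 * i`. So a
radius `a * L ≥ 2 * i` at `v` covers all of it, and its weight disappears. -/
theorem weight_cons_le {c : Fin b → Fin n} (hι : ∀ v, Near G (ι v) (c (ι v)) v)
    (hw : ∀ i, 0 ≤ w i) {L : ℕ} {l : List (Fin n × ℕ)} {v : Fin n} (hv : ¬ Covered G L l v)
    (a : ℕ) : weight ι w G L ((v, a) :: l) ≤
      weight ι w G L l - if 2 * (ι v : ℕ) ≤ a * L then w (ι v) else 0 := by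
  classical
  have h : (if 2 * (ι v : ℕ) ≤ a * L then w (ι v) else 0) =
      ∑ i, if i = ι v then (if 2 * (ι v : ℕ) ≤ a * L then w (ι v) else 0) else 0 := by simp
  rw [weight, weight, h, ← Finset.sum_sub_distrib]
  refine Finset.sum_le_sum fun i _ => ?_
  by_cases hi : i = ι v
  · subst hi
    have hp : ∃ u, ι u = ι v ∧ ¬ Covered G L l u := ⟨v, rfl, hv⟩
    rw [if_pos hp, if_pos rfl]
    split_ifs with h1 h2
    · obtain ⟨u, hu, hu'⟩ := h1
      obtain ⟨p, hp⟩ := hu ▸ hι u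
      obtain ⟨q, hq⟩ := hι v
      refine absurd ⟨_, List.mem_cons_self, p.append q.reverse, ?_⟩ hu'
      rw [SimpleGraph.Walk.length_append, SimpleGraph.Walk.length_reverse]
      simp only; omega
    · simp
    · simp
    · simp [hw]
  · rw [if_neg hi, sub_zero]
    split_ifs with h1 h2
    · exact le_rfl
    · obtain ⟨u, hu, hu'⟩ := h1
      exact absurd ⟨u, hu, fun h => hu' (h.cons _)⟩ h2
    · exact hw i
    · exact le_rfl

/-- The increment is centred for uniform `a'`, so the cross term vanishes and the mean square grows
by the variance, which is at most `1 / K`. -/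
theorem sum_sq_indicator {K a : ℕ} (ha : a < K) (x : ℝ) :
    ∑ a' ∈ Finset.range K, (x + (if a' = a then 1 else 0) - 1 / K) ^ 2 ≤ K * x ^ 2 + 1 := by
  have hK : (0 : ℝ) < K := by exact_mod_cast (Nat.zero_le a).trans_lt ha
  have h : ∀ a' ∈ Finset.range K, (x + (if a' = a then 1 else 0) - 1 / (K : ℝ)) ^ 2 =
      (x - 1 / K) ^ 2 + if a' = a then 2 * (x - 1 / K) + 1 else 0 := by
    intro a' _
    split_ifs <;> ring
  rw [Finset.sum_congr rfl h, Finset.sum_add_distrib, Finset.sum_ite_eq' ,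
    if_pos (Finset.mem_range.2 ha), Finset.sum_const, Finset.card_range, nsmul_eq_mul]
  have h2 : (K : ℝ) * (x - 1 / K) ^ 2 + (2 * (x - 1 / K) + 1) = K * x ^ 2 + 1 - 1 / K := by
    field_simp; ring
  rw [h2]
  have : 0 ≤ 1 / (K : ℝ) := by positivity
  linarith

/-- By `hp` the weight drops by at least `1` on average, paying for the ball just placed. In the
second part, the growth of each squared deviation is paid for by the decrease of `(T - l.length) /
K`. -/
theorem sum_potential_cons_le {c : Fin b → Fin n} (hι : ∀ v, Near G (ι v) (c (ι v)) v)
    (hw : ∀ i, 0 ≤ w i) {K L : ℕ} (hK : 0 < K)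
    (hp : ∀ i : Fin b, K ≤ w i * ((Finset.range K).filter fun a => 2 * (i : ℕ) ≤ a * L).card)
    {T : ℝ} (hT : 0 < T) (D : ℝ) {l : List (Fin n × ℕ)} {v : Fin n} (hv : ¬ Covered G L l v) :
    ∑ a ∈ Finset.range K, potential ι w G K L T D ((v, a) :: l) ≤
      K * potential ι w G K L T D l := by
  have hK' : (0 : ℝ) < K := by exact_mod_cast hK
  simp only [potential, List.length_cons]
  rw [Finset.sum_add_distrib, mul_add, Finset.sum_comm, Finset.mul_sum]
  refine add_le_add ?_ (Finset.sum_le_sum fun a ha => ?_)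
  · rw [← Finset.sum_div, ← mul_div_assoc]
    refine div_le_div_of_nonneg_right ?_ hT.le
    refine (Finset.sum_le_sum fun a _ =>
      add_le_add_left (weight_cons_le hι hw hv a) _).trans ?_
    rw [Finset.sum_add_distrib, Finset.sum_sub_distrib, ← Finset.sum_filter, Finset.sum_const,
      Finset.sum_const, Finset.sum_const, Finset.card_range, nsmul_eq_mul, nsmul_eq_mul,
      nsmul_eq_mul]
    have := hp (ι v)
    push_cast
    linarith
  · rw [← Finset.sum_div, ← mul_div_assoc]
    refine div_le_div_of_nonneg_right ?_ (sq_nonneg D)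
    have h := sum_sq_indicator (Finset.mem_range.1 ha) ((l.map Prod.snd).count a - l.length / K : ℝ)
    rw [Finset.sum_add_distrib, Finset.sum_const, Finset.card_range, nsmul_eq_mul]
    have h2 : ∀ a' ∈ Finset.range K,
        ((((((v, a') :: l).map Prod.snd).count a : ℕ) : ℝ) - ((l.length + 1 : ℕ) : ℝ) / K) ^ 2 =
        (((l.map Prod.snd).count a - l.length / K : ℝ) + (if a' = a then 1 else 0) - 1 / K) ^ 2 := by
      intro a' _
      rw [List.map_cons, List.count_cons]
      by_cases h : a' = a
      · simp [h]; ring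
      · simp [h]; ring
    rw [Finset.sum_congr rfl h2]
    have h3 : (K : ℝ) * ((T - ((l.length + 1 : ℕ) : ℝ)) / K) = T - l.length - 1 := by
      push_cast; field_simp; ring
    have h4 : (K : ℝ) * ((T - (l.length : ℝ)) / K) = T - l.length := by field_simp
    rw [h3, mul_add, h4]
    linarith

end Potential

/-- The first summand is Markov's bound for the number of balls, the second Chebyshev's bound for an
overfull class. Together they are the potential of the empty list. -/
theorem expect_attempt_le {m L r : ℕ} {T : ℝ} {w : Fin (burningNumber G) → ℝ} (hw : ∀ i, 0 ≤ w i)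
    (hp : ∀ i, (2 : ℝ) ^ m ≤
      w i * ((Finset.range (2 ^ m)).filter fun a => 2 * (i : ℕ) ≤ a * L).card)
    (hT : 0 < T) (hTL : T / 2 ^ m < L) :
    (attempt G m L r).expect ((Set.Ioi (2 ^ m * L)).indicator 1) ≤
      ((∑ i, w i) / T + T / (L - T / 2 ^ m) ^ 2) * (Set.Ioi (2 ^ m * L)).indicator 1 r := by
  classical
  obtain ⟨c, hc⟩ := exists_cover G
  choose ι hι using hc
  set D : ℝ := L - T / 2 ^ m with hD
  have hD0 : 0 < D := by linarith
  have hKpos : (0 : ℝ) < 2 ^ m := by positivity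
  rw [attempt, CoinTree.expect_bind]
  simp only [CoinTree.expect]
  by_cases hr : 2 ^ m * L < r
  swap
  · rw [Set.indicator_of_notMem (show r ∉ Set.Ioi (2 ^ m * L) from hr), mul_zero]
    refine (CoinTree.expect_mono (h := fun _ => 0) fun l => ?_).trans (CoinTree.expect_const _ _).le
    rw [Set.indicator_of_notMem]
    simp only [Set.mem_Ioi, not_lt]
    split_ifs
    · omega
    · exact min_le_right _ _
  rw [Set.indicator_of_mem (show r ∈ Set.Ioi (2 ^ m * L) from hr), Pi.one_apply, mul_one]
  set P := potential ι w G (2 ^ m) L T D with hP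
  have hsum : ∀ l : List (Fin n × ℕ), (l.length : ℝ) ≤ T →
      ∀ a ∈ Finset.range (2 ^ m), 0 ≤ (((l.map Prod.snd).count a - l.length / (2 ^ m : ℕ) : ℝ) ^ 2 +
        (T - l.length) / (2 ^ m : ℕ)) / D ^ 2 := by
    intro l hl a _
    have : 0 ≤ T - l.length := by linarith
    positivity
  -- Beyond `T` balls the variance term could turn negative; from there on the pass is counted as
  -- failed.
  let F : List (Fin n × ℕ) → ℝ := fun l => if (l.length : ℝ) ≤ T then P l else 1
  have hF : ∀ i l, (visit G m L i l).expect F ≤ F l := by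
    intro i l
    rw [visit]
    split_ifs with hi hcov
    · exact le_rfl
    · simp only [CoinTree.expect_bind, CoinTree.expect, expect_sample]
      by_cases hl : (l.length : ℝ) + 1 ≤ T
      · have : ∀ a, F ((⟨i, hi⟩, a) :: l) = P ((⟨i, hi⟩, a) :: l) := fun a =>
          if_pos (by push_cast [List.length_cons]; exact hl)
        simp only [this]
        rw [show F l = P l from if_pos (by linarith), div_le_iff₀ hKpos, mul_comm]
        have := sum_potential_cons_le hι hw (K := 2 ^ m) (by positivity)
          (by exact_mod_cast hp) hT D hcov
        exact_mod_cast this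
      · have : ∀ a, F ((⟨i, hi⟩, a) :: l) = 1 := fun a =>
          if_neg (by push_cast [List.length_cons]; exact hl)
        simp only [this, Finset.sum_const, Finset.card_range, nsmul_eq_mul, mul_one]
        push_cast
        rw [div_self hKpos.ne']
        show 1 ≤ if (l.length : ℝ) ≤ T then P l else 1
        split_ifs with hl'
        -- The next ball exceeds `T`. The uncovered vertex contributes weight at least `1`, so
        -- weight plus length is at least `T` and the potential has already reached `1`.
        · have h1 : 1 ≤ w (ι ⟨i, hi⟩) := by
            have h2 := hp (ι ⟨i, hi⟩)
            have h3 : (((Finset.range (2 ^ m)).filter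
                fun a => 2 * (ι ⟨i, hi⟩ : ℕ) ≤ a * L).card : ℝ) ≤ 2 ^ m := by
              have := Finset.card_filter_le (Finset.range (2 ^ m))
                fun a => 2 * (ι ⟨i, hi⟩ : ℕ) ≤ a * L
              rw [Finset.card_range] at this
              exact_mod_cast this
            have h4 := h2.trans (mul_le_mul_of_nonneg_left h3 (hw _))
            exact le_of_mul_le_mul_right (by linarith) hKpos
          have h2 := le_weight (ι := ι) hw hcov
          refine le_add_of_le_of_nonneg ?_ (Finset.sum_nonneg (hsum l hl'))
          rw [le_div_iff₀ hT]
          linarith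
        · exact le_rfl
    · exact le_rfl
  refine (CoinTree.expect_mono (h := F) fun l => ?_).trans
    ((CoinTree.expect_iter_le (fun i _ l => hF i l) []).trans ?_)
  · show _ ≤ if (l.length : ℝ) ≤ T then P l else 1
    split_ifs with ho hl hl
    · obtain ⟨a, ha, hLa⟩ := ho
      refine (Set.indicator_le_self' (fun _ _ => zero_le_one) _).trans ?_
      refine le_add_of_nonneg_of_le
        (div_nonneg (add_nonneg (weight_nonneg hw _ _) (Nat.cast_nonneg _)) hT.le) ?_
      refine le_trans ?_ (Finset.single_le_sum (hsum l hl) (Finset.mem_range.2 ha))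
      rw [le_div_iff₀ (by positivity), one_mul]
      have h1 : 0 ≤ (T - l.length) / ((2 ^ m : ℕ) : ℝ) := div_nonneg (by linarith) (by positivity)
      -- With at most `T` balls, an overfull class deviates from its mean by at least `D`, so its
      -- summand alone is at least `1`.
      have h2 : D ≤ ((l.map Prod.snd).count a - l.length / (2 ^ m : ℕ) : ℝ) := by
        have h3 : (l.length : ℝ) / (2 ^ m : ℕ) ≤ T / 2 ^ m := by push_cast; gcongr
        have h4 : (L : ℝ) ≤ (l.map Prod.snd).count a := by exact_mod_cast hLa.le
        linarith
      have h5 := pow_le_pow_left₀ hD0.le h2 2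
      linarith
    · exact Set.indicator_le_self' (fun _ _ => zero_le_one) _
    · rw [Set.indicator_of_notMem (by simp)]
      exact add_nonneg (div_nonneg (add_nonneg (weight_nonneg hw _ _) (Nat.cast_nonneg _)) hT.le)
        (Finset.sum_nonneg (hsum l hl))
    · rw [Set.indicator_of_notMem (by simp)]
      exact zero_le_one
  · rw [show F [] = P [] from if_pos (by simpa using hT.le)]
    simp only [hP, potential, List.length_nil, List.map_nil, List.count_nil]
    rw [Finset.sum_const, Finset.card_range, nsmul_eq_mul]
    refine add_le_add (div_le_div_of_nonneg_right ?_ hT.le) (le_of_eq ?_)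
    · simpa using weight_nil_le (ι := ι) hw L
    · push_cast
      field_simp
      ring

theorem expect_attempt_le_self (m L R r : ℕ) :
    (attempt G m L r).expect ((Set.Ioi R).indicator 1) ≤ (Set.Ioi R).indicator 1 r := by
  classical
  rw [attempt, CoinTree.expect_bind]
  refine (CoinTree.expect_mono (h := fun _ => (Set.Ioi R).indicator 1 r) fun l => ?_).trans
    (CoinTree.expect_const _ _).le
  have h : (if Overfull (2 ^ m) L l then r else min r (2 ^ m * L)) ≤ r := by
    split_ifs
    · exact le_rfl
    · exact min_le_left _ _
  simp only [CoinTree.expect, Set.indicator_apply, Set.mem_Ioi, Pi.one_apply]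
  by_cases hR : R < r
  · rw [if_pos hR]; split_ifs <;> norm_num
  · rw [if_neg hR, if_neg fun h' => hR (h'.trans_le h)]

/-- If `2 ^ m * L ≤ n`, the pair `(m, L)` is among those tried and its `n` passes multiply the
failure bound; the other stages never raise the result. Otherwise the starting value `n` is already
good enough. -/
theorem expect_approximate_le {m L : ℕ} {T : ℝ} {w : Fin (burningNumber G) → ℝ}
    (hw : ∀ i, 0 ≤ w i) (hp : ∀ i, (2 : ℝ) ^ m ≤
      w i * ((Finset.range (2 ^ m)).filter fun a => 2 * (i : ℕ) ≤ a * L).card)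
    (hT : 0 < T) (hTL : T / 2 ^ m < L) :
    (approximate G).expect ((Set.Ioi (2 ^ m * L)).indicator 1) ≤
      ((∑ i, w i) / T + T / (L - T / 2 ^ m) ^ 2) ^ n := by
  have hq : 0 ≤ (∑ i, w i) / T + T / (L - T / 2 ^ m) ^ 2 := by
    have := Finset.sum_nonneg fun i (_ : i ∈ Finset.univ) => hw i
    positivity
  have hL : 0 < L := by
    have : (0 : ℝ) < L := lt_trans (by positivity) hTL
    exact_mod_cast this
  have h1 : ∀ R m j r, (CoinTree.iter (fun _ => attempt G m (j + 1)) n r).expect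
      ((Set.Ioi R).indicator 1) ≤ (Set.Ioi R).indicator 1 r := fun R m j r =>
    CoinTree.expect_iter_le (fun _ _ r => expect_attempt_le_self m (j + 1) R r) r
  have h2 : ∀ R m r, (CoinTree.iter (fun j => .iter (fun _ => attempt G m (j + 1)) n)
      (n / 2 ^ m) r).expect ((Set.Ioi R).indicator 1) ≤ (Set.Ioi R).indicator 1 r := fun R m r =>
    CoinTree.expect_iter_le (fun j _ r => h1 R m j r) r
  by_cases hn : 2 ^ m * L ≤ n
  · refine CoinTree.expect_iter_le_of_index (j := m) (fun m _ r => h2 _ m r)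
      (Nat.lt_size.2 ((Nat.le_mul_of_pos_right _ hL).trans hn)) (fun r => ?_) n
    have hlt : L - 1 < n / 2 ^ m := by
      have : L ≤ n / 2 ^ m := (Nat.le_div_iff_mul_le (by positivity)).2 (by rwa [mul_comm])
      omega
    refine CoinTree.expect_iter_le_of_index (j := L - 1) (fun j _ r => h1 _ m j r) hlt
      (fun r => ?_) r
    rw [Nat.sub_add_cancel hL]
    refine (CoinTree.expect_iter_le_pow hq (fun _ r => expect_attempt_le hw hp hT hTL) n r).trans ?_
    exact mul_le_of_le_one_right (pow_nonneg hq n)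
      (Set.indicator_le_self' (fun _ _ => zero_le_one) _)
  · refine (CoinTree.expect_iter_le (fun m _ r => h2 _ m r) n).trans ?_
    rw [Set.indicator_of_notMem (show n ∉ Set.Ioi (2 ^ m * L) from fun h => hn (le_of_lt h))]
    exact pow_nonneg hq n

end RAM

namespace RAM

/-! ### The choice of the parameters -/

/-- The approximation ratio `2 / (1 - e⁻²)`. -/
noncomputable def ratio : ℝ := 2 / (1 - Real.exp (-2))

theorem exp_neg_two_lt : Real.exp (-2) < 1 := Real.exp_lt_one_iff.2 (by norm_num)

theorem ratio_pos : 0 < ratio := div_pos two_pos (by linarith [exp_neg_two_lt])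

theorem ratio_bounds : 2.313 < ratio ∧ ratio < 2.314 := by
  have h1 := Real.exp_one_gt_d9
  have h2 := Real.exp_one_lt_d9
  have h : Real.exp (-2) = 1 / (Real.exp 1) ^ 2 := by
    rw [← Real.exp_nat_mul, one_div, ← Real.exp_neg]; norm_num
  have h3 : 0.13533 < Real.exp (-2) := by
    rw [h, lt_div_iff₀ (by positivity)]
    nlinarith
  have h4 : Real.exp (-2) < 0.13534 := by
    rw [h, div_lt_iff₀ (by positivity)]
    nlinarith
  constructor
  · rw [ratio, lt_div_iff₀ (by linarith)]; linarith
  · rw [ratio, div_lt_iff₀ (by linarith)]; linarith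

/-- Some choice of the parameters leads to a solution of size at most `(ratio + η) * b` with the
probability required in each attempt. -/
def Good (η : ℝ) (b : ℕ) : Prop :=
  ∃ (m L : ℕ) (T : ℝ) (w : Fin b → ℝ), (∀ i, 0 ≤ w i) ∧ (∀ i, (2 : ℝ) ^ m ≤
    w i * ((Finset.range (2 ^ m)).filter fun a => 2 * (i : ℕ) ≤ a * L).card) ∧ 0 < T ∧
    T / 2 ^ m < L ∧ (2 ^ m * L : ℝ) ≤ (ratio + η) * b ∧
    (∑ i, w i) / T + T / (L - T / 2 ^ m) ^ 2 ≤ Real.exp (-(1 / √b))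

theorem Good.mono {η η' : ℝ} {b : ℕ} (h : Good η b) (hη : η ≤ η') : Good η' b := by
  obtain ⟨m, L, T, w, h1, h2, h3, h4, h5, h6⟩ := h
  exact ⟨m, L, T, w, h1, h2, h3, h4, h5.trans (by gcongr), h6⟩

/-- Crude parameters for small `b`: two radii, `0` and `100 * b`, the larger of which swallows any
optimal ball. The failure bound `1/50 + 1/(25 * b)` is below `1/3 ≤ exp (-1)`. -/
theorem good_of_pos {b : ℕ} (hb : 0 < b) : Good 200 b := by
  have hb1 : (1 : ℝ) ≤ b := by exact_mod_cast hb
  refine ⟨1, 100 * b, 100 * b, fun _ => 2, fun _ => by norm_num, fun i => ?_, by linarith, ?_, ?_,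
    ?_⟩
  · have : 1 ≤ ((Finset.range (2 ^ 1)).filter fun a => 2 * (i : ℕ) ≤ a * (100 * b)).card :=
      Finset.card_pos.2 ⟨1, by simp; omega⟩
    have : (1 : ℝ) ≤ ((Finset.range (2 ^ 1)).filter fun a => 2 * (i : ℕ) ≤ a * (100 * b)).card := by
      exact_mod_cast this
    linarith
  · push_cast; linarith
  · push_cast
    nlinarith [ratio_pos]
  · have h1 : 1 / √(b : ℝ) ≤ 1 := by
      rw [div_le_one (by positivity)]
      exact Real.one_le_sqrt.2 hb1
    have h2 : Real.exp (-1) ≤ Real.exp (-(1 / √b)) := Real.exp_le_exp.2 (by linarith)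
    have h3 : (1 / 3 : ℝ) ≤ Real.exp (-1) := by
      rw [Real.exp_neg, ← one_div]
      exact one_div_le_one_div_of_le (Real.exp_pos _) (by linarith [Real.exp_one_lt_d9])
    refine le_trans ?_ (h3.trans h2)
    have h4 : (∑ _i : Fin b, (2 : ℝ)) / (100 * b) + 100 * b /
        (((100 * b : ℕ) : ℝ) - 100 * b / 2 ^ 1) ^ 2 = 1 / 50 + 1 / (25 * b) := by
      simp only [Finset.sum_const, Finset.card_univ, Fintype.card_fin, nsmul_eq_mul]
      push_cast
      field_simp
      ring
    rw [h4]
    have : 1 / (25 * (b : ℝ)) ≤ 1 / 25 := one_div_le_one_div_of_le (by norm_num) (by linarith)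
    linarith

/-- At most `j / L + 1` multiples of `L` lie below `j`. The extra `1` is the discretization loss
that becomes `1 / 2 ^ m` in the success probabilities. -/
theorem le_card_filter_add (K j : ℕ) {L : ℕ} (hL : 0 < L) :
    (K : ℝ) ≤ ((Finset.range K).filter fun a => j ≤ a * L).card + (j / L + 1) := by
  have h := Finset.card_filter_add_card_filter_not (s := Finset.range K) fun a => j ≤ a * L
  have h2 : ((Finset.range K).filter fun a => ¬ j ≤ a * L).card ≤ j / L + 1 := by
    rw [← Finset.card_range (j / L + 1)]
    refine Finset.card_le_card fun a ha => ?_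
    rw [Finset.mem_filter] at ha
    rw [Finset.mem_range, Nat.lt_succ_iff]
    exact (Nat.le_div_iff_mul_le hL).2 (by omega)
  rw [Finset.card_range] at h
  have h3 : ((j / L : ℕ) : ℝ) ≤ (j : ℝ) / L := Nat.cast_div_le
  have h4 : (K : ℝ) ≤ ((Finset.range K).filter fun a => j ≤ a * L).card + ((j / L : ℕ) + 1) := by
    exact_mod_cast (by omega : K ≤ ((Finset.range K).filter fun a => j ≤ a * L).card + (j / L + 1))
  linarith

/-- A Riemann sum of `1 / x` bounded by the integral. -/
theorem sum_inv_le_log {δ y : ℝ} (hδ : 0 < δ) {b : ℕ} (hb : 0 < y - δ * b) :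
    ∑ i ∈ Finset.range b, 1 / (y - δ * i) ≤ (Real.log y - Real.log (y - δ * b)) / δ := by
  induction b with
  | zero => simp
  | succ b ih =>
    push_cast at hb ⊢
    have hb' : 0 < y - δ * b := by linarith
    rw [Finset.sum_range_succ]
    -- The inequality `1 - 1/x ≤ log x` at the ratio of consecutive arguments bounds one summand by
    -- one increment of the logarithm.
    have h := Real.one_sub_inv_le_log_of_pos (div_pos hb' hb)
    rw [Real.log_div hb'.ne' hb.ne', inv_div] at h
    have h2 : 1 - (y - δ * (b + 1)) / (y - δ * b) = δ * (1 / (y - δ * b)) := by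
      field_simp; ring
    rw [h2] at h
    have h3 : 1 / (y - δ * b) ≤ (Real.log (y - δ * b) - Real.log (y - δ * (b + 1))) / δ := by
      rw [le_div_iff₀ hδ]; linarith
    refine (add_le_add (ih hb') h3).trans (le_of_eq ?_)
    ring

/-- With `R = 2 ^ m * L` just above `ρ * b`, the weights are reciprocals of lower bounds for the
success probabilities. By `hx` the logarithmic bound makes their sum at most `(1 - 2 * ε) * R`.
Taking `T = (1 - ε) * R` leaves slack `ε * R` both for Markov and, as `D = ε * L`, for Chebyshev. -/
theorem good_of_le {η ρ ε : ℝ} {m b : ℕ} (hρ : 0 < ρ) (hε : 0 < ε) (hε' : ε < 1) (hb : 0 < b)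
    (hx : Real.exp (-2 * (1 - 2 * ε)) ≤ 1 - 1 / 2 ^ m - 2 / ρ)
    (hη : ρ * b + 2 ^ m ≤ (ratio + η) * b)
    (hq : (1 - 2 * ε) / (1 - ε) + 4 ^ m / (ε ^ 2 * ρ) * (1 / b) ≤ Real.exp (-(1 / √b))) :
    Good η b := by
  have hb0 : (0 : ℝ) < b := by exact_mod_cast hb
  have hK : (0 : ℝ) < 2 ^ m := by positivity
  set L := ⌈ρ * b / 2 ^ m⌉₊ with hLdef
  have hL0 : (0 : ℝ) < L := by
    have : 0 < L := Nat.ceil_pos.2 (by positivity)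
    exact_mod_cast this
  set R : ℝ := 2 ^ m * L with hR
  have hR0 : 0 < R := by positivity
  have hR1 : ρ * b ≤ R := by
    have := Nat.le_ceil (ρ * b / 2 ^ m)
    rwa [div_le_iff₀ hK, mul_comm _ ((2 : ℝ) ^ m)] at this
  have hR2 : R ≤ ρ * b + 2 ^ m := by
    have := (Nat.ceil_lt_add_one (by positivity : 0 ≤ ρ * b / 2 ^ m)).le
    calc R ≤ 2 ^ m * (ρ * b / 2 ^ m + 1) := mul_le_mul_of_nonneg_left this hK.le
      _ = ρ * b + 2 ^ m := by field_simp
  have hy : Real.exp (-2 * (1 - 2 * ε)) ≤ 1 - 1 / 2 ^ m - 2 / R * b := by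
    have : 2 / R * b ≤ 2 / ρ := by
      rw [div_mul_eq_mul_div, div_le_div_iff₀ hR0 hρ]; linarith
    linarith
  have hypos : ∀ i : Fin b, 0 < 1 - 1 / 2 ^ m - 2 / R * (i : ℕ) := by
    intro i
    have h1 : ((i : ℕ) : ℝ) ≤ b := by exact_mod_cast i.2.le
    have h2 : 2 / R * (i : ℕ) ≤ 2 / R * b := mul_le_mul_of_nonneg_left h1 (by positivity)
    linarith [Real.exp_pos (-2 * (1 - 2 * ε))]
  refine ⟨m, L, (1 - ε) * R, fun i => 1 / (1 - 1 / 2 ^ m - 2 / R * (i : ℕ)),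
    fun i => (one_div_pos.2 (hypos i)).le, fun i => ?_, mul_pos (by linarith) hR0, ?_,
    hR2.trans hη, ?_⟩
  · have h := le_card_filter_add (2 ^ m) (2 * (i : ℕ)) (L := L) (by exact_mod_cast hL0)
    rw [one_div_mul_eq_div, le_div_iff₀ (hypos i)]
    have h2 : (2 : ℝ) ^ m * (1 - 1 / 2 ^ m - 2 / R * (i : ℕ)) = 2 ^ m - (2 * (i : ℕ) / L + 1) := by
      rw [hR]; field_simp; ring
    rw [h2]
    push_cast at h
    linarith
  · rw [hR, div_lt_iff₀ hK]
    nlinarith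
  · have hsum : ∑ i : Fin b, 1 / (1 - 1 / 2 ^ m - 2 / R * (i : ℕ)) ≤ (1 - 2 * ε) * R := by
      rw [Fin.sum_univ_eq_sum_range (fun i => 1 / (1 - 1 / 2 ^ m - 2 / R * (i : ℝ)))]
      refine (sum_inv_le_log (by positivity) ((Real.exp_pos _).trans_le hy)).trans ?_
      have h1 : Real.log (1 - 1 / 2 ^ m) ≤ 0 := by
        have h2 : 0 < (1 : ℝ) / 2 ^ m := by positivity
        have h3 : 0 < 2 / R * b := by positivity
        exact Real.log_nonpos (by linarith [Real.exp_pos (-2 * (1 - 2 * ε))]) (by linarith)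
      have h2 := (Real.le_log_iff_exp_le ((Real.exp_pos _).trans_le hy)).2 hy
      rw [div_div_eq_mul_div, div_le_iff₀ two_pos]
      nlinarith
    have hR' : (1 - 2 * ε) * R / ((1 - ε) * R) = (1 - 2 * ε) / (1 - ε) := by
      rw [mul_div_mul_right _ _ hR0.ne']
    refine le_trans (add_le_add ((div_le_div_of_nonneg_right hsum (by nlinarith)).trans_eq hR') ?_)
      hq
    · have h4 : (4 : ℝ) ^ m = (2 ^ m) ^ 2 := by rw [← pow_mul, mul_comm, pow_mul]; norm_num
      have h1 : (L : ℝ) - (1 - ε) * R / 2 ^ m = ε * R / 2 ^ m := by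
        rw [hR]; field_simp; ring
      have h2 : (1 - ε) * R / ((L : ℝ) - (1 - ε) * R / 2 ^ m) ^ 2 =
          4 ^ m * (1 - ε) / (ε ^ 2 * R) := by
        rw [h1, h4]; field_simp
      rw [h2, mul_one_div, div_div]
      refine div_le_div₀ (by positivity) (mul_le_of_le_one_right (by positivity) (by linarith))
        (by positivity) ?_
      rw [mul_assoc]
      exact mul_le_mul_of_nonneg_left hR1 (sq_nonneg ε)

/-- Half of `η` makes the inequality behind `ratio` strict, leaving room for `ε` and then for `1 / 2
^ m`. The other half absorbs the rounding error `2 ^ m` once `b` is large. -/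
theorem eventually_good {η : ℝ} (hη : 0 < η) : ∀ᶠ b in atTop, Good η b := by
  set ρ := ratio + η / 2 with hρdef
  have hρ : 0 < ρ := by linarith [ratio_pos]
  have h0 : Real.exp (-2) < 1 - 2 / ρ := by
    have h1 : 2 / ratio = 1 - Real.exp (-2) := by
      rw [ratio, div_div_cancel₀ two_ne_zero]
    have h2 : 2 / ρ < 2 / ratio := div_lt_div_of_pos_left two_pos ratio_pos (by linarith)
    linarith
  obtain ⟨ε, hε, hε0, hε1⟩ : ∃ ε : ℝ, Real.exp (-2 * (1 - 2 * ε)) < 1 - 2 / ρ ∧ 0 < ε ∧ ε < 1 := by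
    have ht : Tendsto (fun ε : ℝ => Real.exp (-2 * (1 - 2 * ε))) (𝓝[>] 0) (𝓝 (Real.exp (-2))) := by
      refine tendsto_nhdsWithin_of_tendsto_nhds ?_
      have : Continuous fun ε : ℝ => Real.exp (-2 * (1 - 2 * ε)) := by fun_prop
      simpa using this.tendsto 0
    have h2 : ∀ᶠ ε : ℝ in 𝓝[>] 0, ε < 1 :=
      eventually_nhdsWithin_of_eventually_nhds (eventually_lt_nhds one_pos)
    obtain ⟨ε, h, h', h''⟩ :=
      ((ht.eventually_lt_const h0).and (eventually_mem_nhdsWithin.and h2)).exists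
    exact ⟨ε, h, h', h''⟩
  obtain ⟨m, hm⟩ := exists_pow_lt_of_lt_one (sub_pos.2 hε) (show (1 / 2 : ℝ) < 1 by norm_num)
  rw [div_pow, one_pow] at hm
  have ht0 : Tendsto (fun b : ℕ => 1 / (b : ℝ)) atTop (𝓝 0) := tendsto_one_div_atTop_nhds_zero_nat
  have ht1 : Tendsto (fun b : ℕ => (1 - 2 * ε) / (1 - ε) + 4 ^ m / (ε ^ 2 * ρ) * (1 / (b : ℝ)))
      atTop (𝓝 ((1 - 2 * ε) / (1 - ε))) := by
    simpa using (ht0.const_mul (4 ^ m / (ε ^ 2 * ρ))).const_add ((1 - 2 * ε) / (1 - ε))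
  have ht2 : Tendsto (fun b : ℕ => Real.exp (-(1 / √(b : ℝ)))) atTop (𝓝 1) := by
    have h1 : Tendsto (fun b : ℕ => 1 / √(b : ℝ)) atTop (𝓝 0) := by
      simp only [one_div]
      exact tendsto_inv_atTop_zero.comp
        (Real.tendsto_sqrt_atTop.comp tendsto_natCast_atTop_atTop)
    simpa [Function.comp_def] using (Real.continuous_exp.tendsto _).comp h1.neg
  have hlt : (1 - 2 * ε) / (1 - ε) < 1 := by
    rw [div_lt_one (by linarith)]; linarith
  have ht3 : ∀ᶠ b : ℕ in atTop, (2 : ℝ) ^ m ≤ η / 2 * b :=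
    (tendsto_natCast_atTop_atTop.const_mul_atTop (half_pos hη)).eventually_ge_atTop _
  filter_upwards [ht1.eventually_lt ht2 hlt, ht3, eventually_gt_atTop 0] with b h1 h2 h3
  refine good_of_le hρ hε0 hε1 h3 (by linarith) ?_ h1.le
  rw [hρdef]
  linarith

/-- Take `e b` to be the infimum of the positive good `η`, plus `1 / (b + 1)` because the infimum
need not be attained. -/
theorem exists_tendsto_good : ∃ e : ℕ → ℝ, Tendsto e atTop (𝓝 0) ∧ ∀ b, 0 < b → Good (e b) b := by
  refine ⟨fun b => sInf {η : ℝ | 0 < η ∧ Good η b} + 1 / ((b : ℝ) + 1), ?_, fun b hb => ?_⟩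
  · suffices h : Tendsto (fun b => sInf {η : ℝ | 0 < η ∧ Good η b}) atTop (𝓝 0) by
      simpa using h.add tendsto_one_div_add_atTop_nhds_zero_nat
    rw [Metric.tendsto_nhds]
    intro δ hδ
    filter_upwards [eventually_good (half_pos hδ)] with b hb
    have h1 : 0 ≤ sInf {η : ℝ | 0 < η ∧ Good η b} := Real.sInf_nonneg fun η hη => hη.1.le
    have h2 : sInf {η : ℝ | 0 < η ∧ Good η b} ≤ δ / 2 :=
      csInf_le ⟨0, fun η hη => hη.1.le⟩ ⟨half_pos hδ, hb⟩
    rw [Real.dist_0_eq_abs, abs_of_nonneg h1]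
    linarith
  · obtain ⟨η, hη, hlt⟩ := exists_lt_of_csInf_lt
      (⟨200, by norm_num, good_of_pos hb⟩ : {η : ℝ | 0 < η ∧ Good η b}.Nonempty)
      (lt_add_of_pos_right _ (Nat.one_div_pos_of_nat (n := b)))
    exact hη.2.mono hlt.le

/-- The rate `1 / √b` tends to `0`, so each pass may fail with probability near `1`. Yet `n / √b ≥
√n`, and `exp (√n)` is at least the term `(√n) ^ (2 * k) / (2 * k)!` of its series. -/
theorem exp_pow_le {n b : ℕ} (hn : 0 < n) (hb : 0 < b) (hbn : b ≤ n) (k : ℕ) :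
    Real.exp (-(1 / √b)) ^ n ≤ (2 * k).factorial / (n : ℝ) ^ k := by
  have hn0 : (0 : ℝ) < n := by exact_mod_cast hn
  have hb0 : (0 : ℝ) < b := by exact_mod_cast hb
  have h1 : √(n : ℝ) ≤ n * (1 / √b) := by
    rw [mul_one_div, le_div_iff₀ (Real.sqrt_pos.2 hb0)]
    calc √(n : ℝ) * √b ≤ √n * √n := by gcongr
      _ = n := Real.mul_self_sqrt hn0.le
  rw [← Real.exp_nat_mul, mul_neg]
  refine (Real.exp_le_exp.2 (neg_le_neg h1)).trans ?_
  have h2 := Real.pow_div_factorial_le_exp (√(n : ℝ)) (Real.sqrt_nonneg _) (2 * k)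
  rw [pow_mul, Real.sq_sqrt hn0.le] at h2
  rw [Real.exp_neg, ← inv_div]
  exact inv_anti₀ (by positivity) h2

end RAM

theorem theorem1 :
    (2.313 < 2 / (1 - Real.exp (-2)) ∧ 2 / (1 - Real.exp (-2)) < 2.314) ∧
    ∃ e : ℕ → ℝ, Tendsto e atTop (𝓝 0) ∧
      ∀ k : ℕ, ∃ A : (n : ℕ) → SimpleGraph (Fin n) → (ℕ → Bool) → ℕ,
        RAM.IsRandomizedPolyTime A ∧
        (∀ (n : ℕ) (G : SimpleGraph (Fin n)) (ω : ℕ → Bool), burningNumber G ≤ A n G ω) ∧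
        ∃ C : ℝ, ∀ (n : ℕ) (G : SimpleGraph (Fin n)), 1 ≤ n →
          coinMeasure.real {ω : ℕ → Bool |
            (2 / (1 - Real.exp (-2)) + e (burningNumber G)) * (burningNumber G : ℝ) <
              (A n G ω : ℝ)} ≤ C / (n : ℝ) ^ k := by
  refine ⟨RAM.ratio_bounds, ?_⟩
  obtain ⟨e, he, hgood⟩ := RAM.exists_tendsto_good
  refine ⟨e, he, fun k => ⟨_, RAM.isRandomizedPolyTime_approximate,
    fun n G ω => (RAM.all_approximate G).run ω 0, (2 * k).factorial, fun n G hn => ?_⟩⟩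
  have hb := RAM.burningNumber_pos hn G
  obtain ⟨m, L, T, w, hw, hp, hT, hTL, hR, hq⟩ := hgood _ hb
  have hq0 : 0 ≤ (∑ i, w i) / T + T / (L - T / 2 ^ m) ^ 2 := by
    have := Finset.sum_nonneg fun i (_ : i ∈ Finset.univ) => hw i
    positivity
  have : IsProbabilityMeasure coinMeasure := by unfold coinMeasure; infer_instance
  refine (measureReal_mono (fun ω hω => ?_)).trans
    ((CoinTree.coinMeasure_run_le (RAM.approximate G) (Set.Ioi (2 ^ m * L))).trans
    ((RAM.expect_approximate_le hw hp hT hTL).trans ((pow_le_pow_left₀ hq0 hq n).trans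
    (RAM.exp_pow_le hn hb (RAM.burningNumber_le_card G) k))))
  have h := hR.trans_lt hω
  show 2 ^ m * L < _
  exact_mod_cast h
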